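/- Let $F$ be an infinite field, $k\ge 0$, and let $\mathbb S(F,\mathbb N)=\langle F,\mathrm{List}(F),\mathbb N;\,t(s,a,i),\,\ell(s)\rangle$ be the list superstructure of $F$: the three-sorted structure consisting of the field $F$, the set $\mathrm{List}(F)$ of finite tuples $s=(s_1,\ldots,s_l)$, $l\ge 1$, of elements of $F$, and the arithmetic $\langle\mathbb N;+,\cdot,0,1\rangle$, with the length function $\ell$ and the predicate $t(s,a,i)$ meaning "$1\le i\le \ell(s)$ and $s_i=a$". A regular interpretation $(\Gamma,\varphi)$ of a structure $\mathbb A$ in a structure $\mathbb B$ consists of a code $\Gamma$ (formulas $U$, $E$ and one formula for each symbol of the language of $\mathbb A$, in the language of $\mathbb B$, with parameter variables $\bar y$) and a formula $\varphi(\bar y)$ satisfiable in $\mathbb B$ such that, for every $\bar p\in\varphi(\mathbb B)$, the formula $U$ with the parameters $\bar p$ defines a set of tuples of $\mathbb B$, $E$ defines an equivalence relation on it, the other formulas define the operations and relations on the quotient, and the resulting structure $\Gamma(\mathbb B,\bar p)$ is isomorphic to $\mathbb A$. The ring $F[x_1,\ldots,x_k]$ is regularly interpretable in $\mathbb S(F,\mathbb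 N)$. Let $(\Gamma,\varphi)$ be any regular interpretation of it in $\mathbb S(F,\mathbb N)$, and let $\mathcal M\equiv\mathbb S(F,\mathbb N)$, with number sort $\widetilde{\mathbb N}$ ordered by $a\le b\iff\exists d\in\widetilde{\mathbb N}\ a+d=b$. Then $\varphi(\mathcal M)\ne\emptyset$, and for every $\bar q\in\varphi(\mathcal M)$ the ring of nonstandard polynomials $\widetilde R=\Gamma(\mathcal M,\bar q)$ is well defined, is a commutative ring, and is nonstandardly Noetherian in the following sense. Suppose that a first-order formula $\Phi(p,n)$ in the language of $\mathcal M$, possibly with parameters from $\mathcal M$ (where $p$ is a tuple of variables representing an element of $\widetilde R$), defines for each $n\in\widetilde{\mathbb N}$ an ideal $I_n$ of $\widetilde R$, so that $I_{n_1}\subseteq I_{n_2}$ whenever $n_1\le n_2$. Then there is $m\in\widetilde{\mathbb N}$ such that $I_n=I_m$ for all $n\ge m$. The case $k=1$ is the statement for nonstandard polynomials in a single variable. -/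

import Mathlib

open FirstOrder

universe u v w

noncomputable section

namespace NonstandardPolynomials

/-! ### Codes of interpretations -/

/-- The code of an interpretation (with parameters) of `L₁`-structures in `L₂`-structures:
`L₂`-formulas for the domain `U ⊆ B ^ dim`, for the equivalence relation on it, and for the
preimages of the graphs of the symbols of `L₁`. The graph of an `n`-ary function symbol has
arity `n + 1`, the value being the last coordinate. The variables in `Fin par` stand for the
parameters. -/
structure Code (L₁ L₂ : FirstOrder.Language.{0, 0}) where
  dim : ℕ
  par : ℕ
  dom : L₂.Formula (Fin dim ⊕ Fin par)
  eqv : L₂.Formula ((Fin 2 × Fin dim) ⊕ Fin par)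
  func : ∀ {n : ℕ}, L₁.Functions n → L₂.Formula ((Fin (n + 1) × Fin dim) ⊕ Fin par)
  rel : ∀ {n : ℕ}, L₁.Relations n → L₂.Formula ((Fin n × Fin dim) ⊕ Fin par)

namespace Code

variable {L₁ L₂ : FirstOrder.Language.{0, 0}}

/-- The set `U` of tuples that the code defines in `M` with the parameters `p`. -/
def Dom (Γ : Code L₁ L₂) (M : Type w) [L₂.Structure M] (p : Fin Γ.par → M) : Type w :=
  {x : Fin Γ.dim → M // Γ.dom.Realize (Sum.elim x p)}

/-- Truth of a formula of the code at an `n`-tuple of elements of the domain. -/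
def Holds (Γ : Code L₁ L₂) {M : Type w} [L₂.Structure M] {p : Fin Γ.par → M} {n : ℕ}
    (φ : L₂.Formula ((Fin n × Fin Γ.dim) ⊕ Fin Γ.par)) (x : Fin n → Γ.Dom M p) : Prop :=
  φ.Realize (Sum.elim (fun ij => (x ij.1).1 ij.2) p)

/-- The relation that the code defines on the domain. -/
def Rel (Γ : Code L₁ L₂) (M : Type w) [L₂.Structure M] (p : Fin Γ.par → M)
    (x y : Γ.Dom M p) : Prop :=
  Γ.Holds Γ.eqv ![x, y]

/-- The underlying set of `Γ(M, p)`. -/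
def Carrier (Γ : Code L₁ L₂) (M : Type w) [L₂.Structure M] (p : Fin Γ.par → M) : Type w :=
  Quot (Γ.Rel M p)

/-- The class in `Γ(M, p)` of an element of the domain. -/
def cls (Γ : Code L₁ L₂) {M : Type w} [L₂.Structure M] {p : Fin Γ.par → M}
    (x : Γ.Dom M p) : Γ.Carrier M p :=
  Quot.mk _ x

/-- The admissibility conditions: the construction of `Γ(M, p)` gives an `L₁`-structure. -/
structure Admissible (Γ : Code L₁ L₂) (M : Type w) [L₂.Structure M] (p : Fin Γ.par → M) :
    Prop where
  equivalence : Equivalence (Γ.Rel M p)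
  func_congr : ∀ {n : ℕ} (f : L₁.Functions n) (x y : Fin (n + 1) → Γ.Dom M p),
    (∀ i, Γ.Rel M p (x i) (y i)) → Γ.Holds (Γ.func f) x → Γ.Holds (Γ.func f) y
  func_total : ∀ {n : ℕ} (f : L₁.Functions n) (x : Fin n → Γ.Dom M p),
    ∃ y : Γ.Dom M p, Γ.Holds (Γ.func f) (Fin.snoc (α := fun _ => Γ.Dom M p) x y)
  func_unique : ∀ {n : ℕ} (f : L₁.Functions n) (x : Fin n → Γ.Dom M p) (y z : Γ.Dom M p),
    Γ.Holds (Γ.func f) (Fin.snoc (α := fun _ => Γ.Dom M p) x y) →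
    Γ.Holds (Γ.func f) (Fin.snoc (α := fun _ => Γ.Dom M p) x z) → Γ.Rel M p y z
  rel_congr : ∀ {n : ℕ} (r : L₁.Relations n) (x y : Fin n → Γ.Dom M p),
    (∀ i, Γ.Rel M p (x i) (y i)) → Γ.Holds (Γ.rel r) x → Γ.Holds (Γ.rel r) y

/-- The `L₁`-structure `Γ(M, p)`. -/
@[reducible]
def toStructure (Γ : Code L₁ L₂) {M : Type w} [L₂.Structure M] {p : Fin Γ.par → M}
    (h : Γ.Admissible M p) : L₁.Structure (Γ.Carrier M p) where
  funMap f a := Γ.cls (Classical.choose (h.func_total f fun i => (a i).out))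
  RelMap r a := Γ.Holds (Γ.rel r) fun i => (a i).out

theorem cls_eq_cls (Γ : Code L₁ L₂) {M : Type w} [L₂.Structure M] {p : Fin Γ.par → M}
    (h : Γ.Admissible M p) (x y : Γ.Dom M p) : Γ.cls x = Γ.cls y ↔ Γ.Rel M p x y :=
  h.equivalence.quot_mk_eq_iff x y

theorem rel_out (Γ : Code L₁ L₂) {M : Type w} [L₂.Structure M] {p : Fin Γ.par → M}
    (h : Γ.Admissible M p) (x : Γ.Dom M p) : Γ.Rel M p (Γ.cls x).out x :=
  (Γ.cls_eq_cls h _ _).1 (Quot.out_eq _)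

/-- In `Γ(M, p)` the formulas of the code define the preimages of the graphs of the function
symbols. -/
theorem funMap_cls (Γ : Code L₁ L₂) {M : Type w} [L₂.Structure M] {p : Fin Γ.par → M}
    (h : Γ.Admissible M p) {n : ℕ} (f : L₁.Functions n) (x : Fin n → Γ.Dom M p)
    (y : Γ.Dom M p) :
    (Γ.toStructure h).funMap f (fun i => Γ.cls (x i)) = Γ.cls y ↔
      Γ.Holds (Γ.func f) (Fin.snoc (α := fun _ => Γ.Dom M p) x y) := by
  have key := Classical.choose_spec (h.func_total f fun i => (Γ.cls (x i)).out)
  have key' : Γ.Holds (Γ.func f) (Fin.snoc (α := fun _ => Γ.Dom M p) x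
      (Classical.choose (h.func_total f fun i => (Γ.cls (x i)).out))) := by
    refine h.func_congr f _ _ (fun i => ?_) key
    refine Fin.lastCases ?_ (fun j => ?_) i
    · simpa using! h.equivalence.refl _
    · simpa using! Γ.rel_out h (x j)
  change Γ.cls _ = Γ.cls y ↔ _
  rw [Γ.cls_eq_cls h]
  constructor
  · intro hr
    refine h.func_congr f _ _ (fun i => ?_) key'
    refine Fin.lastCases ?_ (fun j => ?_) i
    · simpa using! hr
    · simpa using! h.equivalence.refl _
  · intro hy
    exact h.func_unique f x _ _ key' hy

/-- In `Γ(M, p)` the formulas of the code define the preimages of the relations. -/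
theorem relMap_cls (Γ : Code L₁ L₂) {M : Type w} [L₂.Structure M] {p : Fin Γ.par → M}
    (h : Γ.Admissible M p) {n : ℕ} (r : L₁.Relations n) (x : Fin n → Γ.Dom M p) :
    (Γ.toStructure h).RelMap r (fun i => Γ.cls (x i)) ↔ Γ.Holds (Γ.rel r) x :=
  ⟨fun hx => h.rel_congr r _ _ (fun i => Γ.rel_out h (x i)) hx,
    fun hx => h.rel_congr r _ _ (fun i => h.equivalence.symm (Γ.rel_out h (x i))) hx⟩

/-- `(Γ, φ)` is a regular interpretation of `A` in `B`: the formula `φ` for the parameters is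
satisfiable in `B`, and `A ≅ Γ(B, p)` for every tuple `p` that satisfies it. -/
def IsRegularInterpretation (Γ : Code L₁ L₂) (φ : L₂.Formula (Fin Γ.par))
    (B : Type w) [L₂.Structure B] (A : Type v) [L₁.Structure A] : Prop :=
  (∃ p : Fin Γ.par → B, φ.Realize p) ∧
    ∀ p : Fin Γ.par → B, φ.Realize p →
      ∃ h : Γ.Admissible B p,
        Nonempty (@FirstOrder.Language.Equiv L₁ (Γ.Carrier B p) A (Γ.toStructure h) _)

/-- Regular interpretation of a ring `A`, as a structure for the language of rings. -/
def IsRegularRingInterpretation (Γ : Code FirstOrder.Language.ring L₂) (φ : L₂.Formula (Fin Γ.par))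
    (B : Type w) [L₂.Structure B] (A : Type v) [CommRing A] : Prop :=
  letI := FirstOrder.Ring.compatibleRingOfRing A
  Γ.IsRegularInterpretation φ B A

end Code

/-! ### The list superstructure of a field

The three-sorted structure `⟨F, List(F), ℕ; t(s, a, i), ℓ(s)⟩` is written in the usual way as a
one-sorted structure on the disjoint union of the three sorts, with unary predicates for the
sorts and with relations for the operations. -/

/-- The relation symbols of the language of list superstructures of fields. -/
inductive ListRel : ℕ → Type
  | isElt : ListRel 1
  | isList : ListRel 1
  | isNum : ListRel 1
  | eltAdd : ListRel 3
  | eltMul : ListRel 3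
  | eltZero : ListRel 1
  | eltOne : ListRel 1
  | numAdd : ListRel 3
  | numMul : ListRel 3
  | numZero : ListRel 1
  | numOne : ListRel 1
  | len : ListRel 2
  | entry : ListRel 3

/-- The language of list superstructures of fields. -/
def listLang : FirstOrder.Language.{0, 0} where
  Functions := fun _ => Empty
  Relations := ListRel

/-- The underlying set of `𝕊(F, ℕ)`: elements of `F`, tuples `(s₁, …, sₖ)` with `k ≥ 1` of
elements of `F`, and natural numbers. -/
inductive ListSup (F : Type u) : Type u
  | elt (a : F) : ListSup F
  | list (s : {l : List F // l ≠ []}) : ListSup F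
  | num (n : ℕ) : ListSup F

/-- Truth of the atomic relations in `𝕊(F, ℕ)`. The relation `entry` is `t(s, a, i)`, that is,
`1 ≤ i ≤ ℓ(s)` and `sᵢ = a`; the entries of a Lean list are indexed from `0`. -/
def ListSup.Holds {F : Type u} [Field F] : ∀ {n : ℕ}, ListRel n → (Fin n → ListSup F) → Prop
  | _, .isElt, x => ∃ a, x 0 = .elt a
  | _, .isList, x => ∃ s, x 0 = .list s
  | _, .isNum, x => ∃ n, x 0 = .num n
  | _, .eltAdd, x => ∃ a b, x 0 = .elt a ∧ x 1 = .elt b ∧ x 2 = .elt (a + b)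
  | _, .eltMul, x => ∃ a b, x 0 = .elt a ∧ x 1 = .elt b ∧ x 2 = .elt (a * b)
  | _, .eltZero, x => x 0 = .elt 0
  | _, .eltOne, x => x 0 = .elt 1
  | _, .numAdd, x => ∃ m n, x 0 = .num m ∧ x 1 = .num n ∧ x 2 = .num (m + n)
  | _, .numMul, x => ∃ m n, x 0 = .num m ∧ x 1 = .num n ∧ x 2 = .num (m * n)
  | _, .numZero, x => x 0 = .num 0
  | _, .numOne, x => x 0 = .num 1
  | _, .len, x => ∃ s, x 0 = .list s ∧ x 1 = .num s.1.length
  | _, .entry, x =>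
      ∃ s a i, x 0 = .list s ∧ x 1 = .elt a ∧ x 2 = .num (i + 1) ∧ s.1[i]? = some a

instance ListSup.instStructure (F : Type u) [Field F] : listLang.Structure (ListSup F) where
  funMap f := f.elim
  RelMap r x := ListSup.Holds r x

/-! ### The number sort -/

/-- The number sort of a structure in the language of list superstructures. -/
def NumSort (M : Type w) [listLang.Structure M] : Type w :=
  {n : M // FirstOrder.Language.Structure.RelMap (L := listLang) ListRel.isNum ![n]}

/-- The order of the number sort: `a ≤ b` when `a + d = b` for some number `d`. -/
def NumSort.Le {M : Type w} [listLang.Structure M] (a b : NumSort M) : Prop :=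
  ∃ d : NumSort M, FirstOrder.Language.Structure.RelMap (L := listLang) ListRel.numAdd ![a.1, d.1, b.1]

end NonstandardPolynomials

end

open NonstandardPolynomials

/-! The ring `MvPolynomial (Fin k) F` is Noetherian by Hilbert's basis theorem, and the number sort
of `𝕊(F, ℕ)` is the true `ℕ`, so in the standard model every ascending chain of ideals indexed by
numbers stabilizes. Noetherianity is not first-order, but for one fixed `Φ` the claim "for all `q`
in `φ` and all `c`, if `Φ` defines an ascending chain of ideals, then the chain is stationary" is a
single sentence (`chainFormula`, `stableFormula`). It therefore holds in every `M ≡ 𝕊(F, ℕ)`,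
nonstandard parameters `c` included; this is `exists_stable`.

That `Γ(M, q)` exists and is a commutative ring follows in the same way: each admissibility
condition is a formula in the parameters, and the ring axioms are identities, whose validity in
`Γ(M, q)` is expressed by unnesting terms (`realize_identityFormula`).

For the existence of an interpretation, a polynomial is represented by a program: `k + 2` lists of
equal length, read as instructions for two registers `(S, T)` that start at `(0, 0)`. An instruction
`(d, e, l)` replaces `S` by `S + dT` and, with the old `T`, replaces `T` by `(∑ lⱼxⱼ)T + e`. Here
`T` builds a monomial with its coefficient and `S` collects the sum, so every polynomial is computed
(`exists_run_eq`). At a point of `F ^ k` the run is a pair of lists, hence the value is definable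
(`value_iff`). As `F` is infinite, equality and the ring operations of polynomials can be tested on
values (`forall_ringGraph_iff`). -/

noncomputable section

namespace NonstandardPolynomials

open FirstOrder.Language FirstOrder.Ring

/-! ### Formulas about elements of `Γ(M, p)`; admissibility as a first-order condition. -/

namespace Code

variable {L₁ L₂ : FirstOrder.Language.{0, 0}} (Γ : Code L₁ L₂)

/-- Formulas in variables for elements of the domain, indexed by `ι`, and further variables. -/
abbrev DomFormula (ι β : Type) := L₂.Formula ((ι × Fin Γ.dim) ⊕ β)

variable {Γ} {ι κ β : Type} {M : Type w} [L₂.Structure M]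

/-- Truth of a formula in variables for elements of the domain. -/
def Sat {p : Fin Γ.par → M} (b : β → M) (ψ : Γ.DomFormula ι β) (x : ι → Γ.Dom M p) : Prop :=
  ψ.Realize (Sum.elim (fun ij => (x ij.1).1 ij.2) b)

/-- A formula of the code with its variables renamed. -/
def lift (g : Fin Γ.par → β) {n : ℕ} (ψ : L₂.Formula ((Fin n × Fin Γ.dim) ⊕ Fin Γ.par))
    (s : Fin n → ι) : Γ.DomFormula ι β :=
  ψ.relabel (Sum.map (Prod.map s id) g)

/-- The map `g` locates the parameters of the code inside a larger supply `β`, which later also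
holds the parameters of `Φ` and numbers. -/
theorem sat_lift {p : Fin Γ.par → M} {g : Fin Γ.par → β} {b : β → M}
    (hp : b ∘ g = p) {n : ℕ}
    (ψ : L₂.Formula ((Fin n × Fin Γ.dim) ⊕ Fin Γ.par)) (s : Fin n → ι)
    (x : ι → Γ.Dom M p) : Sat b (lift g ψ s) x ↔ Γ.Holds ψ (fun i => x (s i)) := by
  subst hp
  unfold Sat lift Holds
  rw [Formula.realize_relabel]
  apply iff_of_eq
  congr 1
  ext a
  rcases a with ⟨i, j⟩ | a <;> rfl

/-- Quantification over a tuple of elements of the domain. -/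
def domAll [Finite κ] (g : Fin Γ.par → β) (ψ : Γ.DomFormula (ι ⊕ κ) β) : Γ.DomFormula ι β :=
  Formula.iAlls (κ × Fin Γ.dim)
    (((Formula.iInf fun i : κ => Γ.dom.relabel (Sum.map (fun j => (Sum.inr i, j)) g)).imp
      ψ).relabel
      (Sum.elim (fun ij => Sum.elim (fun i => Sum.inl (Sum.inl (i, ij.2)))
        (fun i => Sum.inr (i, ij.2)) ij.1) (fun a => Sum.inl (Sum.inr a))))

/-- Quantification over `M` guarded by the domain formula in each block: a block that passes its
guard is exactly an element of `Γ.Dom M p`. -/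
theorem sat_domAll [Finite κ] {p : Fin Γ.par → M} {g : Fin Γ.par → β} {b : β → M}
    (hp : b ∘ g = p) (ψ : Γ.DomFormula (ι ⊕ κ) β)
    (x : ι → Γ.Dom M p) :
    Sat b (domAll g ψ) x ↔ ∀ z : κ → Γ.Dom M p, Sat b ψ (Sum.elim x z) := by
  subst hp
  unfold Sat domAll
  simp only [Formula.realize_iAlls, Formula.realize_relabel, Formula.realize_imp,
    Formula.realize_iInf]
  constructor
  · intro h z
    have := h (fun ij => (z ij.1).1 ij.2) (fun i => ?_)
    · convert this using 1
      ext a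
      rcases a with ⟨i | i, j⟩ | a <;> rfl
    · convert (z i).2 using 1
      ext a
      rcases a with i | a <;> rfl
  · intro h z hz
    have := h (fun i => ⟨fun j => z (i, j), ?_⟩)
    · convert this using 1
      ext a
      rcases a with ⟨i | i, j⟩ | a <;> rfl
    · convert hz i using 1
      ext a
      rcases a with i | a <;> rfl

/-- Existence of a tuple of elements of the domain. -/
def domEx [Finite κ] (g : Fin Γ.par → β) (ψ : Γ.DomFormula (ι ⊕ κ) β) : Γ.DomFormula ι β :=
  (domAll g ψ.not).not

theorem sat_not {p : Fin Γ.par → M} {b : β → M} (ψ : Γ.DomFormula ι β)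
    (x : ι → Γ.Dom M p) : Sat b ψ.not x ↔ ¬ Sat b ψ x :=
  Formula.realize_not

theorem sat_imp {p : Fin Γ.par → M} {b : β → M} (ψ χ : Γ.DomFormula ι β)
    (x : ι → Γ.Dom M p) : Sat b (ψ.imp χ) x ↔ (Sat b ψ x → Sat b χ x) :=
  Formula.realize_imp

theorem sat_inf {p : Fin Γ.par → M} {b : β → M} (ψ χ : Γ.DomFormula ι β)
    (x : ι → Γ.Dom M p) : Sat b (ψ ⊓ χ) x ↔ (Sat b ψ x ∧ Sat b χ x) :=
  Formula.realize_inf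

theorem sat_iff {p : Fin Γ.par → M} {b : β → M} (ψ χ : Γ.DomFormula ι β)
    (x : ι → Γ.Dom M p) : Sat b (Formula.iff ψ χ) x ↔ (Sat b ψ x ↔ Sat b χ x) :=
  Formula.realize_iff

theorem sat_iInf [Finite κ] {p : Fin Γ.par → M} {b : β → M} (ψ : κ → Γ.DomFormula ι β)
    (x : ι → Γ.Dom M p) : Sat b (Formula.iInf ψ) x ↔ ∀ i, Sat b (ψ i) x :=
  Formula.realize_iInf

theorem sat_domEx [Finite κ] {p : Fin Γ.par → M} {g : Fin Γ.par → β} {b : β → M}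
    (hp : b ∘ g = p) (ψ : Γ.DomFormula (ι ⊕ κ) β)
    (x : ι → Γ.Dom M p) :
    Sat b (domEx g ψ) x ↔ ∃ z : κ → Γ.Dom M p, Sat b ψ (Sum.elim x z) := by
  subst hp
  unfold domEx
  rw [sat_not, sat_domAll rfl]
  simp only [sat_not, not_forall, not_not]

/-- The universal closure of a formula in variables for elements of the domain. -/
def domClosure [Finite κ] (g : Fin Γ.par → β) (ψ : Γ.DomFormula κ β) : L₂.Formula β :=
  (domAll (ι := Empty) g
    (ψ.relabel (Sum.map (Prod.map Sum.inr id) id) : Γ.DomFormula (Empty ⊕ κ) β)).relabel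
    (Sum.elim (fun ij => ij.1.elim) id)

theorem realize_domClosure [Finite κ] {p : Fin Γ.par → M} {g : Fin Γ.par → β} {b : β → M}
    (hp : b ∘ g = p) (ψ : Γ.DomFormula κ β) :
    (domClosure g ψ).Realize b ↔ ∀ z : κ → Γ.Dom M p, Sat b ψ z := by
  subst hp
  have h := sat_domAll (b := b) (rfl : b ∘ g = _)
    (ψ.relabel (Sum.map (Prod.map Sum.inr id) id) : Γ.DomFormula (Empty ⊕ κ) β)
    (fun i => i.elim)
  unfold domClosure
  rw [Formula.realize_relabel]
  have e : (b ∘ (Sum.elim (fun ij => ij.1.elim) id : (Empty × Fin Γ.dim) ⊕ β → β)) =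
      Sum.elim (fun ij : Empty × Fin Γ.dim => ij.1.elim) b := by
    ext a
    rcases a with ⟨i, _⟩ | a
    · exact i.elim
    · rfl
  rw [e]
  refine Iff.trans (iff_of_eq ?_) (h.trans (forall_congr' fun z => ?_))
  · unfold Sat
    congr 1
    ext a
    rcases a with ⟨i, _⟩ | a
    · exact i.elim
    · rfl
  · unfold Sat
    rw [Formula.realize_relabel]
    apply iff_of_eq
    congr 1
    ext a
    rcases a with ⟨i, _⟩ | a <;> rfl

/-- The formula `t(x) = y` about elements of `Γ(M, p)`. -/
def termGraph {ι : Type} : L₁.Term ι → Γ.DomFormula (ι ⊕ Unit) (Fin Γ.par)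
  | .var i => lift id Γ.eqv ![Sum.inl i, Sum.inr ()]
  | .func (l := n) f ts =>
      domEx (κ := Fin n) id
        ((Formula.iInf fun i =>
          ((termGraph (ts i)).relabel
            (Sum.map (Prod.map (Sum.elim (fun j => Sum.inl (Sum.inl j)) fun _ => Sum.inr i) id)
              id) : Γ.DomFormula ((ι ⊕ Unit) ⊕ Fin n) (Fin Γ.par))) ⊓
        lift id (Γ.func f) (Fin.snoc (α := fun _ => (ι ⊕ Unit) ⊕ Fin n) Sum.inr
          (Sum.inl (Sum.inr ()))))

theorem sat_relabel {p : Fin Γ.par → M} {b : β → M} (ψ : Γ.DomFormula ι β) (s : ι → κ)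
    (x : κ → Γ.Dom M p) :
    Sat b (ψ.relabel (Sum.map (Prod.map s id) id) : Γ.DomFormula κ β) x ↔
      Sat b ψ (fun i => x (s i)) := by
  unfold Sat
  rw [Formula.realize_relabel]
  apply iff_of_eq
  congr 1
  ext a
  rcases a with ⟨i, j⟩ | a <;> rfl

theorem cls_surjective {p : Fin Γ.par → M} (a : Γ.Carrier M p) : ∃ x : Γ.Dom M p, Γ.cls x = a :=
  Quot.exists_rep a

theorem snoc_comp {α : Type*} {γ : Type*} {n : ℕ} (x : γ → α) (s : Fin n → γ) (t : γ) :
    (fun i => x (Fin.snoc (α := fun _ => γ) s t i)) =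
      Fin.snoc (α := fun _ => α) (fun i => x (s i)) (x t) := by
  ext i
  refine Fin.lastCases ?_ (fun j => ?_) i <;> simp

/-- The code only supplies graphs of symbols, so a composite term is unnested by quantifying over
representatives of the values of its subterms. -/
theorem sat_termGraph {p : Fin Γ.par → M} (h : Γ.Admissible M p) {ι : Type} (t : L₁.Term ι)
    (x : ι → Γ.Dom M p) (y : Γ.Dom M p) :
    Sat p (termGraph t) (Sum.elim x fun _ => y) ↔
      (letI := Γ.toStructure h; t.realize (fun i => Γ.cls (x i)) = Γ.cls y) := by
  let _ := Γ.toStructure h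
  induction t generalizing y with
  | var i =>
    unfold termGraph
    rw [sat_lift rfl, Term.realize_var, Γ.cls_eq_cls h]
    unfold Rel
    apply iff_of_eq
    congr 1
    ext i
    fin_cases i <;> rfl
  | func f ts ih =>
    unfold termGraph
    rw [sat_domEx (Function.comp_id p)]
    simp only [sat_inf, sat_iInf, sat_lift rfl]
    constructor
    · rintro ⟨z, hz, hf⟩
      rw [snoc_comp] at hf
      have hf' := (Γ.funMap_cls h f z y).2 hf
      rw [Term.realize_func, ← hf']
      congr 1
      ext i
      refine (ih i (z i)).1 ?_
      have := hz i
      rw [sat_relabel] at this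
      convert this using 1
      ext j
      rcases j with j | j <;> rfl
    · intro hy
      choose z hz using fun i => cls_surjective ((ts i).realize (fun i => Γ.cls (x i)))
      refine ⟨z, fun i => ?_, ?_⟩
      · rw [sat_relabel]
        have := (ih i (z i)).2 (hz i).symm
        convert this using 1
        ext j
        rcases j with j | j <;> rfl
      · rw [snoc_comp]
        refine (Γ.funMap_cls h f z y).1 ?_
        rw [← hy, Term.realize_func]
        congr 1
        ext i
        exact hz i

/-- The formula for the validity of the identity `t₁ = t₂` in `Γ(M, p)`. -/
def identityFormula (Γ : Code L₁ L₂) {ι : Type} [Finite ι] (t₁ t₂ : L₁.Term ι) :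
    L₂.Formula (Fin Γ.par) :=
  domClosure (κ := ι ⊕ Unit) id (Formula.iff (termGraph t₁) (termGraph t₂))

theorem realize_identityFormula {p : Fin Γ.par → M} (h : Γ.Admissible M p) {ι : Type} [Finite ι]
    (t₁ t₂ : L₁.Term ι) :
    (Γ.identityFormula t₁ t₂).Realize p ↔
      (letI := Γ.toStructure h
       ∀ a : ι → Γ.Carrier M p, t₁.realize a = t₂.realize a) := by
  let _ := Γ.toStructure h
  unfold identityFormula
  rw [realize_domClosure rfl]
  simp only [sat_iff]
  constructor
  · intro hz a
    choose x hx using fun i => cls_surjective (a i)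
    -- Testing the two graphs at a representative of the value of `t₂` turns equality of graphs into
    -- equality of values.
    obtain ⟨y, hy⟩ := cls_surjective (t₂.realize a)
    obtain rfl : (fun i => Γ.cls (x i)) = a := funext hx
    have := hz (Sum.elim x fun _ => y)
    have e := (sat_termGraph h t₁ x y).symm.trans (this.trans (sat_termGraph h t₂ x y))
    exact (e.2 hy.symm).trans hy
  · intro ha z
    obtain ⟨x, y, rfl⟩ : ∃ x y, z = Sum.elim x fun _ => y :=
      ⟨z ∘ Sum.inl, z (Sum.inr ()), by ext (i | i) <;> rfl⟩
    refine (sat_termGraph h t₁ x y).trans (Iff.trans ?_ (sat_termGraph h t₂ x y).symm)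
    rw [ha]

/-- The formula for the conditions in `Admissible` on the equivalence relation. -/
def eqvFormula (Γ : Code L₁ L₂) : L₂.Formula (Fin Γ.par) :=
  domClosure (κ := Fin 3) id (lift id Γ.eqv ![0, 0] ⊓
    ((lift id Γ.eqv ![0, 1]).imp (lift id Γ.eqv ![1, 0]) ⊓
    (lift id Γ.eqv ![0, 1]).imp ((lift id Γ.eqv ![1, 2]).imp (lift id Γ.eqv ![0, 2]))))

theorem holds_pair (ψ : L₂.Formula ((Fin 2 × Fin Γ.dim) ⊕ Fin Γ.par)) {p : Fin Γ.par → M}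
    (x : ι → Γ.Dom M p) (i j : ι) :
    Γ.Holds ψ (fun l => x (![i, j] l)) ↔ Γ.Holds ψ ![x i, x j] := by
  apply iff_of_eq
  congr 1
  ext l
  fin_cases l <;> rfl

theorem realize_eqvFormula {p : Fin Γ.par → M} :
    Γ.eqvFormula.Realize p ↔ Equivalence (Γ.Rel M p) := by
  unfold eqvFormula
  rw [realize_domClosure rfl]
  simp only [sat_inf, sat_imp, sat_lift rfl, holds_pair]
  constructor
  · intro h
    exact ⟨fun x => (h ![x, x, x]).1, fun {x y} => (h ![x, y, x]).2.1,
      fun {x y z} => (h ![x, y, z]).2.2⟩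
  · intro h x
    exact ⟨h.refl _, h.symm, h.trans⟩

/-- The formula that says that a formula of the code respects the equivalence relation. -/
def congrFormula (Γ : Code L₁ L₂) {n : ℕ} (ψ : L₂.Formula ((Fin n × Fin Γ.dim) ⊕ Fin Γ.par)) :
    L₂.Formula (Fin Γ.par) :=
  domClosure (κ := Fin n ⊕ Fin n) id
    ((Formula.iInf fun i => lift id Γ.eqv ![Sum.inl i, Sum.inr i]).imp
      ((lift id ψ Sum.inl).imp (lift id ψ Sum.inr)))

theorem realize_congrFormula {p : Fin Γ.par → M} {n : ℕ}
    (ψ : L₂.Formula ((Fin n × Fin Γ.dim) ⊕ Fin Γ.par)) :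
    (Γ.congrFormula ψ).Realize p ↔ ∀ x y : Fin n → Γ.Dom M p,
      (∀ i, Γ.Rel M p (x i) (y i)) → Γ.Holds ψ x → Γ.Holds ψ y := by
  unfold congrFormula
  rw [realize_domClosure rfl]
  simp only [sat_imp, sat_iInf, sat_lift rfl, holds_pair]
  exact ⟨fun h x y => h (Sum.elim x y), fun h z => h _ _⟩

/-- The formula that says that a function symbol gives a total relation. -/
def totalFormula (Γ : Code L₁ L₂) {n : ℕ} (f : L₁.Functions n) : L₂.Formula (Fin Γ.par) :=
  domClosure (κ := Fin n) id
    (domEx (κ := Unit) id (lift id (Γ.func f)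
      (Fin.snoc (α := fun _ => Fin n ⊕ Unit) Sum.inl (Sum.inr ()))))

theorem realize_totalFormula {p : Fin Γ.par → M} {n : ℕ} (f : L₁.Functions n) :
    (Γ.totalFormula f).Realize p ↔ ∀ x : Fin n → Γ.Dom M p, ∃ y : Γ.Dom M p,
      Γ.Holds (Γ.func f) (Fin.snoc (α := fun _ => Γ.Dom M p) x y) := by
  unfold totalFormula
  rw [realize_domClosure rfl]
  simp only [sat_domEx rfl, sat_lift rfl, snoc_comp]
  exact forall_congr' fun x => ⟨fun ⟨z, hz⟩ => ⟨z (), hz⟩, fun ⟨y, hy⟩ => ⟨fun _ => y, hy⟩⟩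

/-- The formula that says that a function symbol gives a single-valued relation. -/
def uniqueFormula (Γ : Code L₁ L₂) {n : ℕ} (f : L₁.Functions n) : L₂.Formula (Fin Γ.par) :=
  domClosure (κ := Fin n ⊕ Fin 2) id
    ((lift id (Γ.func f) (Fin.snoc (α := fun _ => Fin n ⊕ Fin 2) Sum.inl (Sum.inr 0))).imp
      ((lift id (Γ.func f) (Fin.snoc (α := fun _ => Fin n ⊕ Fin 2) Sum.inl (Sum.inr 1))).imp
        (lift id Γ.eqv ![Sum.inr 0, Sum.inr 1])))

theorem realize_uniqueFormula {p : Fin Γ.par → M} {n : ℕ} (f : L₁.Functions n) :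
    (Γ.uniqueFormula f).Realize p ↔ ∀ (x : Fin n → Γ.Dom M p) (y z : Γ.Dom M p),
      Γ.Holds (Γ.func f) (Fin.snoc (α := fun _ => Γ.Dom M p) x y) →
      Γ.Holds (Γ.func f) (Fin.snoc (α := fun _ => Γ.Dom M p) x z) → Γ.Rel M p y z := by
  unfold uniqueFormula
  rw [realize_domClosure rfl]
  simp only [sat_imp, sat_lift rfl, snoc_comp, holds_pair]
  exact ⟨fun h x y z => h (Sum.elim x ![y, z]), fun h z => h _ _ _⟩

end Code

/-! ### Transfer along elementary equivalence. -/

section Transfer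

variable {L : FirstOrder.Language.{0, 0}} {M : Type w} {N : Type u} [L.Structure M] [L.Structure N]

/-- Finitely many variables can be closed off universally, which makes the implication a sentence.
-/
theorem transfer_forall {β : Type} [Finite β] (hMN : M ≅[L] N) (φ ψ : L.Formula β)
    (h : ∀ p : β → N, φ.Realize p → ψ.Realize p) (q : β → M) (hq : φ.Realize q) :
    ψ.Realize q := by
  let σ : L.Sentence := Formula.iAlls β ((φ.imp ψ).relabel Sum.inr)
  have keyM : M ⊨ σ ↔ ∀ p : β → M, φ.Realize p → ψ.Realize p := by
    simp only [σ, Sentence.Realize, Formula.realize_iAlls, Formula.realize_relabel,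
      Formula.realize_imp]
    rfl
  have keyN : N ⊨ σ ↔ ∀ p : β → N, φ.Realize p → ψ.Realize p := by
    simp only [σ, Sentence.Realize, Formula.realize_iAlls, Formula.realize_relabel,
      Formula.realize_imp]
    rfl
  exact keyM.1 ((elementarilyEquivalent_iff.1 hMN σ).2 (keyN.2 h)) q hq

theorem transfer_exists {β : Type} [Finite β] (hMN : M ≅[L] N) (φ : L.Formula β)
    (h : ∃ p : β → N, φ.Realize p) : ∃ q : β → M, φ.Realize q := by
  by_contra hne
  push Not at hne
  obtain ⟨p, hp⟩ := h
  exact transfer_forall hMN.symm φ ⊥ (fun q hq => (hne q hq).elim) p hp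

/-- The conditions are transferred one symbol at a time, so `L₁` may have infinitely many symbols.
-/
theorem Code.Admissible.transfer {L₁ : FirstOrder.Language.{0, 0}} {Γ : Code L₁ L}
    (hMN : M ≅[L] N) (φ : L.Formula (Fin Γ.par))
    (h : ∀ p : Fin Γ.par → N, φ.Realize p → Γ.Admissible N p) (q : Fin Γ.par → M)
    (hq : φ.Realize q) : Γ.Admissible M q where
  equivalence := realize_eqvFormula.1 (transfer_forall hMN φ _
    (fun p hp => realize_eqvFormula.2 (h p hp).equivalence) q hq)
  func_congr f := (realize_congrFormula _).1 (transfer_forall hMN φ _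
    (fun p hp => (realize_congrFormula _).2 ((h p hp).func_congr f)) q hq)
  func_total f := (realize_totalFormula _).1 (transfer_forall hMN φ _
    (fun p hp => (realize_totalFormula _).2 ((h p hp).func_total f)) q hq)
  func_unique f := (realize_uniqueFormula _).1 (transfer_forall hMN φ _
    (fun p hp => (realize_uniqueFormula _).2 ((h p hp).func_unique f)) q hq)
  rel_congr r := (realize_congrFormula _).1 (transfer_forall hMN φ _
    (fun p hp => (realize_congrFormula _).2 ((h p hp).rel_congr r)) q hq)

theorem Code.identity_transfer {L₁ : FirstOrder.Language.{0, 0}} {Γ : Code L₁ L}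
    (hMN : M ≅[L] N) (φ : L.Formula (Fin Γ.par)) {ι : Type} [Finite ι] (t₁ t₂ : L₁.Term ι)
    (h : ∀ p : Fin Γ.par → N, φ.Realize p → ∃ h : Γ.Admissible N p,
      letI := Γ.toStructure h
      ∀ a : ι → Γ.Carrier N p, t₁.realize a = t₂.realize a)
    (q : Fin Γ.par → M) (hq : φ.Realize q) (hM : Γ.Admissible M q) :
    letI := Γ.toStructure hM
    ∀ a : ι → Γ.Carrier M q, t₁.realize a = t₂.realize a :=
  (realize_identityFormula hM t₁ t₂).1 (transfer_forall hMN φ _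
    (fun p hp => (realize_identityFormula (h p hp).1 t₁ t₂).2 (h p hp).2) q hq)

end Transfer

/-! ### Commutative rings axiomatized by identities. -/

section CommRing

/-- A structure in the language of rings that satisfies the identities of a commutative ring is
a commutative ring. -/
theorem exists_commRing_of_identities {R : Type w} [S : Language.ring.Structure R] {A : Type v}
    [CommRing A] [CompatibleRing A]
    (h : ∀ t₁ t₂ : Language.ring.Term (Fin 3),
      (∀ a : Fin 3 → A, t₁.realize a = t₂.realize a) →
        ∀ a : Fin 3 → R, t₁.realize a = t₂.realize a) :
    ∃ _ : CommRing R, (compatibleRingOfRing R).toStructure = S := by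
  let _ := addOfRingStructure R
  let _ := mulOfRingStructure R
  let _ := negOfRingStructure R
  let _ := zeroOfRingStructure R
  let _ := oneOfRingStructure R
  let _ := compatibleRingOfRingStructure R
  let x : Language.ring.Term (Fin 3) := .var 0
  let y : Language.ring.Term (Fin 3) := .var 1
  let z : Language.ring.Term (Fin 3) := .var 2
  -- These axioms are identities in at most three variables; superfluous places of the valuation are
  -- filled by repetition.
  let I : CommRing R := CommRing.ofMinimalAxioms
    (fun a b c => by
      simpa [x, y, z] using h (x + y + z) (x + (y + z)) (fun v => by simp [add_assoc]) ![a, b, c])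
    (fun a => by simpa [x] using h (0 + x) x (fun v => by simp) ![a, a, a])
    (fun a => by simpa [x] using h (-x + x) 0 (fun v => by simp) ![a, a, a])
    (fun a b c => by
      simpa [x, y, z] using h (x * y * z) (x * (y * z)) (fun v => by simp [mul_assoc]) ![a, b, c])
    (fun a b => by
      simpa [x, y] using h (x * y) (y * x) (fun v => by simp [mul_comm]) ![a, b, b])
    (fun a => by simpa [x] using h (1 * x) x (fun v => by simp) ![a, a, a])
    (fun a b c => by
      simpa [x, y, z] using h (x * (y + z)) (x * y + x * z) (fun v => by simp [mul_add]) ![a, b, c])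
  refine ⟨I, ?_⟩
  ext n f v
  · cases f
    · exact (CompatibleRing.funMap_add v).symm
    · exact (CompatibleRing.funMap_mul v).symm
    · exact (CompatibleRing.funMap_neg v).symm
    · exact (CompatibleRing.funMap_zero v).symm
    · exact (CompatibleRing.funMap_one v).symm
  · cases f

end CommRing

namespace Code

/-! ### The ring operations of `Γ(M, q)` read off from the code. -/

section RingCode

variable {L : FirstOrder.Language.{0, 0}} {Γ : Code Language.ring L} {M : Type w} [L.Structure M]
  {q : Fin Γ.par → M} (h : Γ.Admissible M q) [CommRing (Γ.Carrier M q)]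
  (hS : (compatibleRingOfRing (Γ.Carrier M q)).toStructure = Γ.toStructure h)

include h hS

theorem holds_zero (x : Fin 1 → Γ.Dom M q) :
    Γ.Holds (Γ.func zeroFunc) x ↔ Γ.cls (x 0) = 0 := by
  have := Γ.funMap_cls h zeroFunc ![] (x 0)
  rw [← hS] at this
  have e : Fin.snoc (α := fun _ => Γ.Dom M q) ![] (x 0) = x := by
    ext i; fin_cases i; rfl
  rw [e] at this
  exact this.symm.trans eq_comm

theorem holds_add (x : Fin 3 → Γ.Dom M q) :
    Γ.Holds (Γ.func addFunc) x ↔ Γ.cls (x 0) + Γ.cls (x 1) = Γ.cls (x 2) := by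
  have := Γ.funMap_cls h addFunc ![x 0, x 1] (x 2)
  rw [← hS] at this
  have e : Fin.snoc (α := fun _ => Γ.Dom M q) ![x 0, x 1] (x 2) = x := by
    ext i; fin_cases i <;> rfl
  rw [e] at this
  exact this.symm

theorem holds_mul (x : Fin 3 → Γ.Dom M q) :
    Γ.Holds (Γ.func mulFunc) x ↔ Γ.cls (x 0) * Γ.cls (x 1) = Γ.cls (x 2) := by
  have := Γ.funMap_cls h mulFunc ![x 0, x 1] (x 2)
  rw [← hS] at this
  have e : Fin.snoc (α := fun _ => Γ.Dom M q) ![x 0, x 1] (x 2) = x := by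
    ext i; fin_cases i <;> rfl
  rw [e] at this
  exact this.symm

end RingCode

/-! ### Definable ascending chains of ideals -/

section Chains

variable {M : Type w} [listLang.Structure M] {β : Type}

/-- An atomic formula in the language of list superstructures. -/
def relFormula {α : Type} {n : ℕ} (R : ListRel n) (a : Fin n → α) : listLang.Formula α :=
  Relations.formula (L := listLang) (n := n) R fun i => Term.var (a i)

theorem realize_relFormula {α : Type} {n : ℕ} (R : ListRel n) (a : Fin n → α) (v : α → M) :
    (relFormula R a).Realize v ↔ Structure.RelMap (L := listLang) R fun i => v (a i) :=
  Formula.realize_rel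

/-- Quantification over a tuple of numbers. -/
def numAll {k : ℕ} (ψ : listLang.Formula (β ⊕ Fin k)) : listLang.Formula β :=
  Formula.iAlls (Fin k)
    ((Formula.iInf fun i : Fin k => relFormula .isNum fun _ => Sum.inr i).imp ψ)

theorem realize_numAll {k : ℕ} (ψ : listLang.Formula (β ⊕ Fin k)) (b : β → M) :
    (numAll ψ).Realize b ↔
      ∀ n : Fin k → NumSort M, ψ.Realize (Sum.elim b fun i => (n i).1) := by
  unfold numAll
  simp only [Formula.realize_iAlls, Formula.realize_imp, Formula.realize_iInf,
    realize_relFormula, Sum.elim_inr]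
  have e : ∀ x : M, (fun _ : Fin 1 => x) = ![x] := fun x => by
    ext j
    fin_cases j
    rfl
  simp only [e]
  exact ⟨fun h n => h (fun i => (n i).1) fun i => (n i).2, fun h x hx => h fun i => ⟨x i, hx i⟩⟩

/-- The formula `n₀ + n₁ = n₂` about numbers. -/
def addFormula : listLang.Formula (β ⊕ Fin 3) :=
  relFormula .numAdd Sum.inr

theorem realize_addFormula (b : β → M) (n : Fin 3 → M) :
    addFormula.Realize (Sum.elim b n) ↔
      Structure.RelMap (L := listLang) ListRel.numAdd ![n 0, n 1, n 2] := by
  unfold addFormula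
  rw [realize_relFormula]
  apply iff_of_eq
  congr 1
  ext i
  fin_cases i <;> rfl

variable {Γ : Code Language.ring listLang} {r : ℕ}

/-- The formula `Φ` at the element `i` of a tuple in the domain and the number `j`. -/
def chainAt (Φ : listLang.Formula ((Fin Γ.dim ⊕ Unit) ⊕ Fin r)) {ι : Type} (i : ι) (j : Fin 3) :
    Γ.DomFormula ι ((Fin Γ.par ⊕ Fin r) ⊕ Fin 3) :=
  Φ.relabel (Sum.elim (Sum.elim (fun l => Sum.inl (i, l)) fun _ => Sum.inr (Sum.inr j))
    fun c => Sum.inr (Sum.inl (Sum.inr c)))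

theorem sat_chainAt (Φ : listLang.Formula ((Fin Γ.dim ⊕ Unit) ⊕ Fin r)) {ι : Type} (i : ι)
    (j : Fin 3) {q : Fin Γ.par → M} {c : Fin r → M} {n : Fin 3 → M} (x : ι → Γ.Dom M q) :
    Sat (Sum.elim (Sum.elim q c) n) (chainAt Φ i j) x ↔
      Φ.Realize (Sum.elim (Sum.elim (x i).1 fun _ => n j) c) := by
  unfold Sat chainAt
  rw [Formula.realize_relabel]
  apply iff_of_eq
  congr 1
  ext a
  rcases a with (l | a) | a <;> rfl

theorem params_comp {M : Type w} (q : Fin Γ.par → M) (c : Fin r → M) (n : Fin 3 → M) :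
    Sum.elim (Sum.elim q c) n ∘ Sum.inl ∘ Sum.inl = q :=
  rfl

/-- The formula that says that `Φ` defines an ascending chain of ideals. -/
def chainFormula (Φ : listLang.Formula ((Fin Γ.dim ⊕ Unit) ⊕ Fin r)) :
    listLang.Formula (Fin Γ.par ⊕ Fin r) :=
  numAll (k := 3)
    (domClosure (κ := Fin 3) (Sum.inl ∘ Sum.inl)
      ((lift (Sum.inl ∘ Sum.inl) Γ.eqv ![0, 1]).imp ((chainAt Φ 0 0).imp (chainAt Φ 1 0)) ⊓
      ((lift (Sum.inl ∘ Sum.inl) (Γ.func zeroFunc) ![0]).imp (chainAt Φ 0 0) ⊓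
      ((lift (Sum.inl ∘ Sum.inl) (Γ.func addFunc) ![0, 1, 2]).imp
        ((chainAt Φ 0 0).imp ((chainAt Φ 1 0).imp (chainAt Φ 2 0))) ⊓
      (lift (Sum.inl ∘ Sum.inl) (Γ.func mulFunc) ![0, 1, 2]).imp ((chainAt Φ 1 0).imp (chainAt Φ 2 0))))) ⊓
    addFormula.imp (domClosure (κ := Fin 1) (Sum.inl ∘ Sum.inl)
      ((chainAt Φ 0 0).imp (chainAt Φ 0 2))))

/-- The formula that says that the chain defined by `Φ` stabilizes. -/
def stableFormula (Φ : listLang.Formula ((Fin Γ.dim ⊕ Unit) ⊕ Fin r)) :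
    listLang.Formula (Fin Γ.par ⊕ Fin r) :=
  (numAll (k := 1) (numAll (k := 2) ((addFormula.imp
    (domClosure (κ := Fin 1) (Sum.inl ∘ Sum.inl)
      ((chainAt Φ 0 2).imp (chainAt Φ 0 0)))).relabel
    (Sum.elim (fun b => Sum.inl (Sum.inl b))
      ![Sum.inl (Sum.inr 0), Sum.inr 0, Sum.inr 1]))).not).not

variable {q : Fin Γ.par → M} {c : Fin r → M}
  {Φ : listLang.Formula ((Fin Γ.dim ⊕ Unit) ⊕ Fin r)}

/-- The number `n 0` is the index of the ideal in all clauses. The other two serve only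
monotonicity: `n 1` is the difference witnessing `n 0 ≤ n 2`. The first clause makes `Φ` descend to
the quotient. -/
theorem realize_chainFormula :
    (chainFormula Φ).Realize (Sum.elim q c) ↔
      ∀ n : Fin 3 → NumSort M, (∀ x : Fin 3 → Γ.Dom M q,
        (Γ.Rel M q (x 0) (x 1) →
          Φ.Realize (Sum.elim (Sum.elim (x 0).1 fun _ => (n 0).1) c) →
          Φ.Realize (Sum.elim (Sum.elim (x 1).1 fun _ => (n 0).1) c)) ∧
        (Γ.Holds (Γ.func zeroFunc) ![x 0] →
          Φ.Realize (Sum.elim (Sum.elim (x 0).1 fun _ => (n 0).1) c)) ∧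
        (Γ.Holds (Γ.func addFunc) ![x 0, x 1, x 2] →
          Φ.Realize (Sum.elim (Sum.elim (x 0).1 fun _ => (n 0).1) c) →
          Φ.Realize (Sum.elim (Sum.elim (x 1).1 fun _ => (n 0).1) c) →
          Φ.Realize (Sum.elim (Sum.elim (x 2).1 fun _ => (n 0).1) c)) ∧
        (Γ.Holds (Γ.func mulFunc) ![x 0, x 1, x 2] →
          Φ.Realize (Sum.elim (Sum.elim (x 1).1 fun _ => (n 0).1) c) →
          Φ.Realize (Sum.elim (Sum.elim (x 2).1 fun _ => (n 0).1) c))) ∧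
        (Structure.RelMap (L := listLang) ListRel.numAdd ![(n 0).1, (n 1).1, (n 2).1] →
          ∀ x : Fin 1 → Γ.Dom M q,
            Φ.Realize (Sum.elim (Sum.elim (x 0).1 fun _ => (n 0).1) c) →
            Φ.Realize (Sum.elim (Sum.elim (x 0).1 fun _ => (n 2).1) c)) := by
  unfold chainFormula
  rw [realize_numAll]
  refine forall_congr' fun n => ?_
  rw [Formula.realize_inf, Formula.realize_imp, realize_domClosure (params_comp q c _), realize_domClosure (params_comp q c _),
    realize_addFormula]
  have e1 : ∀ (x : Fin 3 → Γ.Dom M q) (i : Fin 3), (fun j => x (![i] j)) = ![x i] := by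
    intro x i; ext j; fin_cases j; rfl
  have e3 : ∀ (x : Fin 3 → Γ.Dom M q) (i j k : Fin 3),
      (fun l => x (![i, j, k] l)) = ![x i, x j, x k] := by
    intro x i j k; ext l; fin_cases l <;> rfl
  refine and_congr (forall_congr' fun x => ?_) (imp_congr Iff.rfl (forall_congr' fun x => ?_))
  · rw [sat_inf, sat_inf, sat_inf, sat_imp, sat_imp, sat_imp, sat_imp, sat_imp, sat_imp, sat_imp,
      sat_imp, sat_chainAt, sat_chainAt, sat_chainAt, sat_lift (params_comp q c _), sat_lift (params_comp q c _), sat_lift (params_comp q c _), sat_lift (params_comp q c _)]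
    have e2 := holds_pair Γ.eqv x 0 1
    rw [← e1 x 0, ← e3 x 0 1 2]
    exact and_congr (imp_congr e2 Iff.rfl) Iff.rfl
  · rw [sat_imp, sat_chainAt, sat_chainAt]

theorem realize_stableFormula :
    (stableFormula Φ).Realize (Sum.elim q c) ↔
      ∃ m : NumSort M, ∀ n : NumSort M, m.Le n → ∀ x : Γ.Dom M q,
        Φ.Realize (Sum.elim (Sum.elim x.1 fun _ => n.1) c) →
        Φ.Realize (Sum.elim (Sum.elim x.1 fun _ => m.1) c) := by
  -- After the relabelling, the three number places hold `m`, the difference and the larger index,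
  -- as `addFormula` expects.
  have key : ∀ (m : Fin 1 → NumSort M) (n : Fin 2 → NumSort M),
      (Sum.elim (Sum.elim (Sum.elim q c) fun i => (m i).1) (fun i => (n i).1)) ∘
        (Sum.elim (fun b => Sum.inl (Sum.inl b)) ![Sum.inl (Sum.inr 0), Sum.inr 0, Sum.inr 1]) =
      Sum.elim (Sum.elim q c) ![(m 0).1, (n 0).1, (n 1).1] := by
    intro m n
    ext a
    rcases a with a | i
    · rfl
    · fin_cases i <;> rfl
  have key2 : ∀ (m d n : M) (x : Fin 1 → Γ.Dom M q),
      Sat (Sum.elim (Sum.elim q c) ![m, d, n]) ((chainAt Φ 0 2).imp (chainAt Φ 0 0)) x ↔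
      (Φ.Realize (Sum.elim (Sum.elim (x 0).1 fun _ => n) c) →
        Φ.Realize (Sum.elim (Sum.elim (x 0).1 fun _ => m) c)) := by
    intro m d n x
    rw [sat_imp, sat_chainAt, sat_chainAt]
    rfl
  unfold stableFormula
  rw [Formula.realize_not, realize_numAll, not_forall]
  simp only [Formula.realize_not, not_not, realize_numAll, Formula.realize_relabel]
  constructor
  · rintro ⟨m, hm⟩
    refine ⟨m 0, fun n ⟨d, hd⟩ x => ?_⟩
    have := hm ![d, n]
    rw [key, Formula.realize_imp, realize_addFormula, realize_domClosure (params_comp q c _)] at this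
    exact (key2 _ _ _ _).1 (this hd fun _ => x)
  · rintro ⟨m, hm⟩
    refine ⟨fun _ => m, fun n => ?_⟩
    rw [key, Formula.realize_imp, realize_addFormula, realize_domClosure (params_comp q c _)]
    exact fun hn x => (key2 _ _ _ _).2 (hm (n 1) ⟨n 0, hn⟩ (x 0))

theorem realize_stableFormula_iff [CommRing (Γ.Carrier M q)]
    (I : NumSort M → Ideal (Γ.Carrier M q))
    (hI : ∀ (n : NumSort M) (x : Γ.Dom M q),
      Γ.cls x ∈ I n ↔ Φ.Realize (Sum.elim (Sum.elim x.1 fun _ => n.1) c)) :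
    (stableFormula Φ).Realize (Sum.elim q c) ↔
      ∃ m : NumSort M, ∀ n : NumSort M, m.Le n → I n ≤ I m := by
  rw [realize_stableFormula]
  simp only [← hI]
  refine exists_congr fun m => forall_congr' fun n => imp_congr_right fun _ => ?_
  constructor
  · intro hx a ha
    obtain ⟨x, rfl⟩ := cls_surjective a
    exact hx x ha
  · exact fun hle x hx => hle hx

variable (h : Γ.Admissible M q) [CommRing (Γ.Carrier M q)]
  (hS : (compatibleRingOfRing (Γ.Carrier M q)).toStructure = Γ.toStructure h)

include h hS

theorem realize_chainFormula_of_ideals (I : NumSort M → Ideal (Γ.Carrier M q))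
    (hI : ∀ (n : NumSort M) (x : Γ.Dom M q),
      Γ.cls x ∈ I n ↔ Φ.Realize (Sum.elim (Sum.elim x.1 fun _ => n.1) c))
    (hmono : ∀ n₁ n₂ : NumSort M, n₁.Le n₂ → I n₁ ≤ I n₂) :
    (chainFormula Φ).Realize (Sum.elim q c) := by
  rw [realize_chainFormula]
  intro n
  simp only [← hI, ← Γ.cls_eq_cls h, holds_zero h hS, holds_add h hS, holds_mul h hS]
  refine ⟨fun x => ⟨fun e hx => e ▸ hx, fun e => ?_, fun e hx hy => ?_, fun e hy => ?_⟩,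
    fun hn x hx => hmono _ _ ⟨n 1, hn⟩ hx⟩
  · have e' : Γ.cls (x 0) = 0 := e
    rw [e']
    exact zero_mem _
  · have e' : Γ.cls (x 0) + Γ.cls (x 1) = Γ.cls (x 2) := e
    rw [← e']
    exact add_mem hx hy
  · have e' : Γ.cls (x 0) * Γ.cls (x 1) = Γ.cls (x 2) := e
    rw [← e']
    exact Ideal.mul_mem_left _ _ hy

/-- Needed in the standard model, where transfer supplies only the truth of `chainFormula` and the
ideals have to be rebuilt. -/
theorem exists_ideals_of_realize_chainFormula
    (hΦ : (chainFormula Φ).Realize (Sum.elim q c)) :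
    ∃ I : NumSort M → Ideal (Γ.Carrier M q), (∀ (n : NumSort M) (x : Γ.Dom M q),
        Γ.cls x ∈ I n ↔ Φ.Realize (Sum.elim (Sum.elim x.1 fun _ => n.1) c)) ∧
      ∀ n₁ n₂ : NumSort M, n₁.Le n₂ → I n₁ ≤ I n₂ := by
  rw [realize_chainFormula] at hΦ
  simp only [← Γ.cls_eq_cls h, holds_zero h hS, holds_add h hS, holds_mul h hS] at hΦ
  have hcongr : ∀ (n : NumSort M) (x y : Γ.Dom M q), Γ.cls x = Γ.cls y →
      Φ.Realize (Sum.elim (Sum.elim x.1 fun _ => n.1) c) →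
      Φ.Realize (Sum.elim (Sum.elim y.1 fun _ => n.1) c) :=
    fun n x y => ((hΦ fun _ => n).1 ![x, y, y]).1
  -- Membership defined by some representative agrees with `Φ` at every representative, because `Φ`
  -- respects the equivalence.
  have hmem : ∀ (n : NumSort M) (x : Γ.Dom M q),
      (∃ y : Γ.Dom M q, Γ.cls y = Γ.cls x ∧
        Φ.Realize (Sum.elim (Sum.elim y.1 fun _ => n.1) c)) ↔
      Φ.Realize (Sum.elim (Sum.elim x.1 fun _ => n.1) c) :=
    fun n x => ⟨fun ⟨y, e, hy⟩ => hcongr n y x e hy, fun hx => ⟨x, rfl, hx⟩⟩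
  let I : NumSort M → Ideal (Γ.Carrier M q) := fun n =>
    { carrier := {a | ∃ y : Γ.Dom M q, Γ.cls y = a ∧
        Φ.Realize (Sum.elim (Sum.elim y.1 fun _ => n.1) c)}
      add_mem' := by
        rintro _ _ ⟨x, rfl, hx⟩ ⟨y, rfl, hy⟩
        obtain ⟨z, hz⟩ := cls_surjective (Γ.cls x + Γ.cls y)
        exact ⟨z, hz, ((hΦ fun _ => n).1 ![x, y, z]).2.2.1 hz.symm hx hy⟩
      zero_mem' := by
        obtain ⟨z, hz⟩ := cls_surjective (0 : Γ.Carrier M q)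
        exact ⟨z, hz, ((hΦ fun _ => n).1 ![z, z, z]).2.1 hz⟩
      smul_mem' := by
        rintro a _ ⟨y, rfl, hy⟩
        obtain ⟨x, rfl⟩ := cls_surjective a
        obtain ⟨z, hz⟩ := cls_surjective (Γ.cls x * Γ.cls y)
        exact ⟨z, hz, ((hΦ fun _ => n).1 ![x, y, z]).2.2.2 hz.symm hy⟩ }
  refine ⟨I, hmem, ?_⟩
  rintro n₁ n₂ ⟨d, hd⟩ _ ⟨x, rfl, hx⟩
  exact ⟨x, rfl, (hΦ ![n₁, d, n₂]).2 hd ![x] hx⟩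

end Chains

end Code

/-! ### The standard model -/

section Standard

variable {F : Type u} [Field F]

/-- A natural number as an element of the number sort of `𝕊(F, ℕ)`. -/
def NumSort.ofNat (F : Type u) [Field F] (n : ℕ) : NumSort (ListSup F) :=
  ⟨.num n, n, rfl⟩

theorem NumSort.ofNat_surjective : Function.Surjective (NumSort.ofNat F) := by
  rintro ⟨_, n, hn⟩
  exact ⟨n, Subtype.ext hn.symm⟩

theorem NumSort.ofNat_le {m n : ℕ} :
    (NumSort.ofNat F m).Le (NumSort.ofNat F n) ↔ m ≤ n := by
  constructor
  · rintro ⟨d, a, b, h₁, h₂, h₃⟩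
    simp only [ofNat, Matrix.cons_val_zero, Matrix.cons_val_one, Matrix.cons_val] at h₁ h₂ h₃
    cases h₁
    cases h₃
    exact Nat.le_add_right _ _
  · intro hmn
    refine ⟨NumSort.ofNat F (n - m), m, n - m, rfl, rfl, ?_⟩
    simp [ofNat, Nat.add_sub_cancel' hmn]

/-- Here the index set is `ℕ` with its usual order, so the ordinary ascending chain condition
applies. -/
theorem exists_stable_of_isNoetherianRing {R : Type w} [CommRing R] [IsNoetherianRing R]
    (I : NumSort (ListSup F) → Ideal R)
    (hmono : ∀ n₁ n₂ : NumSort (ListSup F), n₁.Le n₂ → I n₁ ≤ I n₂) :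
    ∃ m : NumSort (ListSup F), ∀ n, m.Le n → I n ≤ I m := by
  let J : ℕ →o Ideal R :=
    ⟨fun n => I (NumSort.ofNat F n), fun m n hmn => hmono _ _ (NumSort.ofNat_le.2 hmn)⟩
  obtain ⟨m, hm⟩ := monotone_stabilizes_iff_noetherian.2 ‹IsNoetherianRing R› J
  refine ⟨NumSort.ofNat F m, fun n hn => ?_⟩
  obtain ⟨n, rfl⟩ := NumSort.ofNat_surjective n
  exact (hm n (NumSort.ofNat_le.1 hn)).ge

end Standard

/-! ### Regular interpretations of rings in nonstandard models. -/

namespace Code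

section Regular

variable {L : FirstOrder.Language.{0, 0}} {Γ : Code Language.ring L}
  {φ : L.Formula (Fin Γ.par)} {B : Type u} [L.Structure B] {A : Type v} [CommRing A]

theorem IsRegularRingInterpretation.identity (hΓ : Γ.IsRegularRingInterpretation φ B A)
    (t₁ t₂ : Language.ring.Term (Fin 3))
    (ht : letI := compatibleRingOfRing A
      ∀ a : Fin 3 → A, t₁.realize a = t₂.realize a)
    (p : Fin Γ.par → B) (hp : φ.Realize p) :
    ∃ h : Γ.Admissible B p,
      letI := Γ.toStructure h
      ∀ a : Fin 3 → Γ.Carrier B p, t₁.realize a = t₂.realize a := by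
  let _ := compatibleRingOfRing A
  obtain ⟨h, ⟨e⟩⟩ := hΓ.2 p hp
  let _ := Γ.toStructure h
  refine ⟨h, fun a => e.injective ?_⟩
  rw [← HomClass.realize_term e, ← HomClass.realize_term e]
  exact ht _

/-- Identities of `A` pass to each `Γ(B, p)` by isomorphism and then to `Γ(M, q)` by transfer. -/
theorem IsRegularRingInterpretation.exists_commRing {M : Type w} [L.Structure M]
    (hΓ : Γ.IsRegularRingInterpretation φ B A) (hMB : M ≅[L] B) (q : Fin Γ.par → M)
    (hq : φ.Realize q) :
    ∃ (h : Γ.Admissible M q) (_ : CommRing (Γ.Carrier M q)),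
      (compatibleRingOfRing (Γ.Carrier M q)).toStructure = Γ.toStructure h := by
  let _ := compatibleRingOfRing A
  have h : Γ.Admissible M q := .transfer hMB φ (fun p hp => (hΓ.2 p hp).1) q hq
  let _ := Γ.toStructure h
  refine ⟨h, exists_commRing_of_identities (A := A) fun t₁ t₂ ht => ?_⟩
  exact identity_transfer hMB φ t₁ t₂ (hΓ.identity t₁ t₂ ht) q hq h

theorem IsRegularRingInterpretation.isNoetherianRing [IsNoetherianRing A]
    (hΓ : Γ.IsRegularRingInterpretation φ B A) (p : Fin Γ.par → B) (hp : φ.Realize p)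
    (h : Γ.Admissible B p) [CommRing (Γ.Carrier B p)]
    (hS : (compatibleRingOfRing (Γ.Carrier B p)).toStructure = Γ.toStructure h) :
    IsNoetherianRing (Γ.Carrier B p) := by
  let _ := compatibleRingOfRing A
  let _ := compatibleRingOfRing (Γ.Carrier B p)
  obtain ⟨h', ⟨e⟩⟩ := hΓ.2 p hp
  -- This makes `e` an isomorphism for the given ring structure, hence a ring isomorphism with `A`.
  rw [← hS] at e
  exact isNoetherianRing_of_ringEquiv A (languageEquivEquivRingEquiv e).symm

end Regular

section Chains

variable {F : Type u} [Field F] {Γ : Code Language.ring listLang}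
  {φ : listLang.Formula (Fin Γ.par)} {A : Type v} [CommRing A] [IsNoetherianRing A]

/-- In a regular interpretation of a Noetherian ring in the list superstructure of a field, every
definable ascending chain of ideals stabilizes. -/
theorem IsRegularRingInterpretation.realize_stableFormula
    (hΓ : Γ.IsRegularRingInterpretation φ (ListSup F) A) {r : ℕ}
    (Φ : listLang.Formula ((Fin Γ.dim ⊕ Unit) ⊕ Fin r)) (p : Fin Γ.par → ListSup F)
    (hp : φ.Realize p) (c : Fin r → ListSup F)
    (hΦ : (chainFormula Φ).Realize (Sum.elim p c)) :
    (stableFormula Φ).Realize (Sum.elim p c) := by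
  -- The standard model is treated as elementarily equivalent to itself.
  obtain ⟨h, _, hS⟩ := hΓ.exists_commRing rfl p hp
  have := hΓ.isNoetherianRing p hp h hS
  obtain ⟨I, hI, hmono⟩ := exists_ideals_of_realize_chainFormula h hS hΦ
  exact (realize_stableFormula_iff I hI).2 (exists_stable_of_isNoetherianRing I hmono)

theorem IsRegularRingInterpretation.exists_stable {M : Type w} [listLang.Structure M]
    (hΓ : Γ.IsRegularRingInterpretation φ (ListSup F) A) (hM : M ≅[listLang] ListSup F) {r : ℕ}
    (Φ : listLang.Formula ((Fin Γ.dim ⊕ Unit) ⊕ Fin r)) (q : Fin Γ.par → M)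
    (hq : φ.Realize q) (c : Fin r → M) (h : Γ.Admissible M q) [CommRing (Γ.Carrier M q)]
    (hS : (compatibleRingOfRing (Γ.Carrier M q)).toStructure = Γ.toStructure h)
    (I : NumSort M → Ideal (Γ.Carrier M q))
    (hI : ∀ (n : NumSort M) (x : Γ.Dom M q),
      Γ.cls x ∈ I n ↔ Φ.Realize (Sum.elim (Sum.elim x.1 fun _ => n.1) c))
    (hmono : ∀ n₁ n₂ : NumSort M, n₁.Le n₂ → I n₁ ≤ I n₂) :
    ∃ m : NumSort M, ∀ n : NumSort M, m.Le n → I n = I m := by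
  have hstable : (stableFormula Φ).Realize (Sum.elim q c) := by
    -- The pair `(q, c)` is quantified as a whole, so `c` needs no counterpart in the standard
    -- model.
    refine transfer_forall hM (φ.relabel Sum.inl ⊓ chainFormula Φ) _ (fun b hb => ?_) _
      (Formula.realize_inf.2 ⟨Formula.realize_relabel.2 hq,
        realize_chainFormula_of_ideals h hS I hI hmono⟩)
    rw [Formula.realize_inf, Formula.realize_relabel] at hb
    rw [← Sum.elim_comp_inl_inr b] at hb ⊢
    exact hΓ.realize_stableFormula Φ _ hb.1 _ hb.2
  obtain ⟨m, hm⟩ := (realize_stableFormula_iff I hI).1 hstable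
  exact ⟨m, fun n hn => le_antisymm (hm n hn) (hmono m n hn)⟩

end Chains

end Code

/-! ### Interpretations given by a parametrization -/

namespace Code

variable {L₁ L₂ : FirstOrder.Language.{0, 0}} {Γ : Code L₁ L₂} {B : Type w} [L₂.Structure B]
  {p : Fin Γ.par → B} {A : Type v} [L₁.Structure A]

/-- A parametrization of `A` by the domain of a code, under which the formulas of the code define
the preimages of equality and of the symbols, makes the code an interpretation of `A`. -/
theorem exists_equiv_of_parametrization (π : Γ.Dom B p → A) (hπ : Function.Surjective π)
    (heqv : ∀ x y, Γ.Rel B p x y ↔ π x = π y)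
    (hfunc : ∀ {n : ℕ} (f : L₁.Functions n) (x : Fin (n + 1) → Γ.Dom B p),
      Γ.Holds (Γ.func f) x ↔
        Structure.funMap f (fun i => π (x i.castSucc)) = π (x (Fin.last n)))
    (hrel : ∀ {n : ℕ} (r : L₁.Relations n) (x : Fin n → Γ.Dom B p),
      Γ.Holds (Γ.rel r) x ↔ Structure.RelMap r (fun i => π (x i))) :
    ∃ h : Γ.Admissible B p,
      Nonempty (@FirstOrder.Language.Equiv L₁ (Γ.Carrier B p) A (Γ.toStructure h) _) := by
  have h : Γ.Admissible B p :=
    { equivalence :=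
        ⟨fun x => (heqv x x).2 rfl, fun hxy => (heqv _ _).2 ((heqv _ _).1 hxy).symm,
          fun hxy hyz => (heqv _ _).2 (((heqv _ _).1 hxy).trans ((heqv _ _).1 hyz))⟩
      func_congr := fun f x y hxy hx => by
        have e : ∀ i, π (x i) = π (y i) := fun i => (heqv _ _).1 (hxy i)
        rw [hfunc] at hx ⊢
        simpa only [e] using hx
      func_total := fun f x => by
        obtain ⟨y, hy⟩ := hπ (Structure.funMap f fun i => π (x i))
        refine ⟨y, (hfunc _ _).2 ?_⟩
        simp [hy]
      func_unique := fun f x y z hy hz => by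
        rw [hfunc] at hy hz
        simp only [Fin.snoc_castSucc, Fin.snoc_last] at hy hz
        exact (heqv _ _).2 (hy.symm.trans hz)
      rel_congr := fun r x y hxy hx => by
        have e : ∀ i, π (x i) = π (y i) := fun i => (heqv _ _).1 (hxy i)
        rw [hrel] at hx ⊢
        simpa only [e] using hx }
  let _ := Γ.toStructure h
  have hcongr : ∀ x y, Γ.Rel B p x y → π x = π y := fun x y => (heqv x y).1
  let g : Γ.Carrier B p → A := Quot.lift π hcongr
  have hg : ∀ x, g (Γ.cls x) = π x := fun _ => rfl
  have hbij : Function.Bijective g := by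
    constructor
    · intro a b hab
      obtain ⟨x, rfl⟩ := cls_surjective a
      obtain ⟨y, rfl⟩ := cls_surjective b
      exact (Γ.cls_eq_cls h _ _).2 ((heqv _ _).2 hab)
    · intro a
      obtain ⟨x, rfl⟩ := hπ a
      exact ⟨Γ.cls x, rfl⟩
  refine ⟨h, ⟨{ Equiv.ofBijective g hbij with map_fun' := ?_, map_rel' := ?_ }⟩⟩
  · intro n f a
    choose x hx using fun i => cls_surjective (a i)
    obtain rfl : (fun i => Γ.cls (x i)) = a := funext hx
    obtain ⟨y, hy⟩ := cls_surjective (Structure.funMap f fun i => Γ.cls (x i))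
    have := (hfunc f _).1 ((Γ.funMap_cls h f x y).1 hy.symm)
    simp only [Fin.snoc_castSucc, Fin.snoc_last] at this
    simp only [Equiv.toFun_as_coe, Function.comp_def, Equiv.ofBijective_apply, ← hy]
    exact this.symm
  · intro n r a
    choose x hx using fun i => cls_surjective (a i)
    obtain rfl : (fun i => Γ.cls (x i)) = a := funext hx
    exact ((Γ.relMap_cls h r x).trans (hrel r x)).symm

end Code

/-! ### Definable relations on the list superstructure -/

section Definable

variable {F : Type u} [Field F] {α β : Type}

/-- Relations on `𝕊(F, ℕ)` that are definable without parameters. -/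
def IsDef (P : (α → ListSup F) → Prop) : Prop :=
  ∃ φ : listLang.Formula α, ∀ v, φ.Realize v ↔ P v

namespace IsDef

theorem congr {P Q : (α → ListSup F) → Prop} (h : IsDef P) (e : ∀ v, P v ↔ Q v) : IsDef Q :=
  let ⟨φ, hφ⟩ := h
  ⟨φ, fun v => (hφ v).trans (e v)⟩

theorem and {P Q : (α → ListSup F) → Prop} (hP : IsDef P) (hQ : IsDef Q) :
    IsDef fun v => P v ∧ Q v := by
  obtain ⟨φ, hφ⟩ := hP
  obtain ⟨ψ, hψ⟩ := hQ
  exact ⟨φ ⊓ ψ, fun v => by rw [Formula.realize_inf, hφ, hψ]⟩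

theorem imp {P Q : (α → ListSup F) → Prop} (hP : IsDef P) (hQ : IsDef Q) :
    IsDef fun v => P v → Q v := by
  obtain ⟨φ, hφ⟩ := hP
  obtain ⟨ψ, hψ⟩ := hQ
  exact ⟨φ.imp ψ, fun v => by rw [Formula.realize_imp, hφ, hψ]⟩

theorem forall_finite [Finite β] {P : β → (α → ListSup F) → Prop} (h : ∀ i, IsDef (P i)) :
    IsDef fun v => ∀ i, P i v := by
  choose φ hφ using h
  exact ⟨Formula.iInf φ, fun v => by simp only [Formula.realize_iInf, hφ]⟩

theorem comp {P : (β → ListSup F) → Prop} (h : IsDef P) (g : β → α) :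
    IsDef fun v : α → ListSup F => P fun b => v (g b) := by
  obtain ⟨φ, hφ⟩ := h
  exact ⟨φ.relabel g, fun v => by rw [Formula.realize_relabel, hφ]; rfl⟩

theorem forall_tuple [Finite β] {P : (α → ListSup F) → (β → ListSup F) → Prop}
    (h : IsDef fun v : α ⊕ β → ListSup F => P (fun a => v (.inl a)) fun b => v (.inr b)) :
    IsDef fun v => ∀ x, P v x := by
  obtain ⟨φ, hφ⟩ := h
  exact ⟨φ.iAlls β, fun v => by simp only [Formula.realize_iAlls, hφ]; rfl⟩

theorem exists_tuple [Finite β] {P : (α → ListSup F) → (β → ListSup F) → Prop}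
    (h : IsDef fun v : α ⊕ β → ListSup F => P (fun a => v (.inl a)) fun b => v (.inr b)) :
    IsDef fun v => ∃ x, P v x := by
  obtain ⟨φ, hφ⟩ := h
  exact ⟨φ.iExs β, fun v => by simp only [Formula.realize_iExs, hφ]; rfl⟩

theorem all {P : (α → ListSup F) → ListSup F → Prop}
    (h : IsDef fun v : α ⊕ Unit → ListSup F => P (fun a => v (.inl a)) (v (.inr ()))) :
    IsDef fun v => ∀ x, P v x :=
  (forall_tuple (P := fun v x => P v (x ())) h).congr
    fun _ => ⟨fun h x => h fun _ => x, fun h x => h (x ())⟩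

theorem ex {P : (α → ListSup F) → ListSup F → Prop}
    (h : IsDef fun v : α ⊕ Unit → ListSup F => P (fun a => v (.inl a)) (v (.inr ()))) :
    IsDef fun v => ∃ x, P v x :=
  (exists_tuple (P := fun v x => P v (x ())) h).congr
    fun _ => ⟨fun ⟨x, h⟩ => ⟨x (), h⟩, fun ⟨x, h⟩ => ⟨fun _ => x, h⟩⟩

theorem rel {n : ℕ} (R : ListRel n) (a : Fin n → α) :
    IsDef fun v : α → ListSup F => ListSup.Holds R fun i => v (a i) :=
  ⟨Code.relFormula R a, Code.realize_relFormula R a⟩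

theorem rel₁ (R : ListRel 1) (a : α) :
    IsDef fun v : α → ListSup F => ListSup.Holds R ![v a] :=
  (rel R ![a]).congr fun v => iff_of_eq <| congrArg _ <| by ext i; fin_cases i; rfl

theorem rel₂ (R : ListRel 2) (a b : α) :
    IsDef fun v : α → ListSup F => ListSup.Holds R ![v a, v b] :=
  (rel R ![a, b]).congr fun v => iff_of_eq <| congrArg _ <| by ext i; fin_cases i <;> rfl

theorem rel₃ (R : ListRel 3) (a b c : α) :
    IsDef fun v : α → ListSup F => ListSup.Holds R ![v a, v b, v c] :=
  (rel R ![a, b, c]).congr fun v => iff_of_eq <| congrArg _ <| by ext i; fin_cases i <;> rfl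

theorem eq (a b : α) : IsDef fun v : α → ListSup F => v a = v b :=
  ⟨(Term.var a).equal (Term.var b), fun v => by simp⟩

end IsDef

end Definable

/-! ### Execution of programs as a definable relation. -/

namespace ListSup

variable {F : Type u} [Field F]

@[simp]
theorem holds_eltAdd {a b : F} {z : ListSup F} :
    Holds .eltAdd ![elt a, elt b, z] ↔ z = elt (a + b) := by
  simp [Holds]

@[simp]
theorem holds_eltMul {a b : F} {z : ListSup F} :
    Holds .eltMul ![elt a, elt b, z] ↔ z = elt (a * b) := by
  simp [Holds]

@[simp]
theorem holds_eltZero {z : ListSup F} : Holds .eltZero ![z] ↔ z = elt 0 := Iff.rfl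

@[simp]
theorem holds_eltOne {z : ListSup F} : Holds .eltOne ![z] ↔ z = elt 1 := Iff.rfl

@[simp]
theorem holds_len {s : {l : List F // l ≠ []}} {z : ListSup F} :
    Holds .len ![list s, z] ↔ z = num s.1.length := by
  simp [Holds]

-- Places in `t(s, a, i)` start at `1`, so place `i + 1` is position `i` of the Lean list.
@[simp]
theorem holds_entry {s : {l : List F // l ≠ []}} {z : ListSup F} {i : ℕ} :
    Holds .entry ![list s, z, num (i + 1)] ↔ ∃ a, s.1[i]? = some a ∧ z = elt a := by
  simp [Holds, and_comm]

/-- `j` is the successor of the number `i`. -/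
def Succ (i j : ListSup F) : Prop :=
  ∃ o, Holds .numOne ![o] ∧ Holds .numAdd ![i, o, j]

theorem succ_iff {i j : ListSup F} : Succ i j ↔ ∃ n, i = num n ∧ j = num (n + 1) := by
  unfold Succ
  constructor
  · rintro ⟨o, rfl, m, n, h₁, h₂, h₃⟩
    simp only [Matrix.cons_val_zero, Matrix.cons_val_one, Matrix.cons_val] at h₁ h₂ h₃
    cases h₂
    exact ⟨m, h₁, h₃⟩
  · rintro ⟨n, rfl, rfl⟩
    exact ⟨num 1, rfl, n, 1, rfl, rfl, rfl⟩

theorem isDef_succ {α : Type} (i j : α) : IsDef fun v : α → ListSup F => Succ (v i) (v j) :=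
  .ex <| .and (.rel₁ _ _) (.rel₃ _ _ _ _)

/-- `u` is the linear combination of `x` whose coefficients are the entries at `i` of the
lists `l`. -/
def LinComb : ∀ {n : ℕ}, (Fin n → ListSup F) → (Fin n → ListSup F) → ListSup F → ListSup F → Prop
  | 0, _, _, _, u => Holds .eltZero ![u]
  | n + 1, l, x, i, u => ∃ t b w, LinComb (fun j : Fin n => l j.castSucc)
      (fun j : Fin n => x j.castSucc) i t ∧ Holds .entry ![l (Fin.last n), b, i] ∧
      Holds .eltMul ![b, x (Fin.last n), w] ∧ Holds .eltAdd ![t, w, u]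

theorem linComb_iff {n : ℕ} (s : Fin n → {l : List F // l ≠ []}) (a c : Fin n → F) (i : ℕ)
    (hs : ∀ j, (s j).1[i]? = some (c j)) (u : ListSup F) :
    LinComb (fun j => list (s j)) (fun j => elt (a j)) (num (i + 1)) u ↔
      u = elt (∑ j, c j * a j) := by
  induction n generalizing u with
  | zero => simp [LinComb]
  | succ n ih =>
    unfold LinComb
    rw [Fin.sum_univ_castSucc]
    simp only [ih (fun j => s j.castSucc) (fun j => a j.castSucc) (fun j => c j.castSucc)
      fun j => hs _]
    simp [hs]

/-- The number of summands is fixed outside the structure, so the recursion unfolds to one formula.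
-/
theorem isDef_linComb {α : Type} {n : ℕ} (l x : Fin n → α) (i u : α) :
    IsDef fun v : α → ListSup F =>
      LinComb (fun j => v (l j)) (fun j => v (x j)) (v i) (v u) := by
  induction n generalizing α with
  | zero => exact .rel₁ _ _
  | succ n ih =>
    refine .ex <| .ex <| .ex <| .and ?_ <| .and (.rel₃ _ _ _ _) <| .and (.rel₃ _ _ _ _)
      (.rel₃ _ _ _ _)
    exact ih _ _ _ _

/-- The lists `S` and `T` follow the program `p` at the point `x` from place `i` to place `j`,
where `d` is the instruction in `p 0` at `i`. -/
def Step {k : ℕ} (p : Fin (k + 2) → ListSup F) (x : Fin k → ListSup F)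
    (S T i j d : ListSup F) : Prop :=
  ∃ e s t s' t' w u z, Holds .entry ![p 1, e, i] ∧ Holds .entry ![S, s, i] ∧
    Holds .entry ![T, t, i] ∧ Holds .entry ![S, s', j] ∧ Holds .entry ![T, t', j] ∧
    Holds .eltMul ![d, t, w] ∧ Holds .eltAdd ![s, w, s'] ∧
    LinComb (fun l => p l.succ.succ) x i u ∧ Holds .eltMul ![u, t, z] ∧ Holds .eltAdd ![z, e, t']

theorem isDef_step {α : Type} {k : ℕ} (p : Fin (k + 2) → α) (x : Fin k → α) (S T i j d : α) :
    IsDef fun v : α → ListSup F =>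
      Step (fun l => v (p l)) (fun l => v (x l)) (v S) (v T) (v i) (v j) (v d) := by
  refine .ex <| .ex <| .ex <| .ex <| .ex <| .ex <| .ex <| .ex <| .and (.rel₃ _ _ _ _) <|
    .and (.rel₃ _ _ _ _) <| .and (.rel₃ _ _ _ _) <| .and (.rel₃ _ _ _ _) <|
    .and (.rel₃ _ _ _ _) <| .and (.rel₃ _ _ _ _) <| .and (.rel₃ _ _ _ _) <| .and ?_ <|
    .and (.rel₃ _ _ _ _) (.rel₃ _ _ _ _)
  exact isDef_linComb _ _ _ _

/-- The program `p` has the value `y` at the point `x`. -/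
def Value {k : ℕ} (p : Fin (k + 2) → ListSup F) (x : Fin k → ListSup F) (y : ListSup F) : Prop :=
  ∃ S T n m o z, Holds .len ![p 0, n] ∧ Succ n m ∧ Holds .numOne ![o] ∧ Holds .eltZero ![z] ∧
    Holds .entry ![S, z, o] ∧ Holds .entry ![T, z, o] ∧ Holds .entry ![S, y, m] ∧
    ∀ i j d, Succ i j → Holds .entry ![p 0, d, i] → Step p x S T i j d

/-- Programs have unbounded length; one formula suffices because the whole run is coded by two
existentially quantified lists. -/
theorem isDef_value {α : Type} {k : ℕ} (p : Fin (k + 2) → α) (x : Fin k → α) (y : α) :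
    IsDef fun v : α → ListSup F => Value (fun l => v (p l)) (fun l => v (x l)) (v y) := by
  refine .ex <| .ex <| .ex <| .ex <| .ex <| .ex <| .and (.rel₂ _ _ _) <|
    .and (isDef_succ _ _) <| .and (.rel₁ _ _) <| .and (.rel₁ _ _) <| .and (.rel₃ _ _ _ _) <|
    .and (.rel₃ _ _ _ _) <| .and (.rel₃ _ _ _ _) <| .all <| .all <| .all <|
    .imp (isDef_succ _ _) <| .imp (.rel₃ _ _ _ _) ?_
  exact isDef_step _ _ _ _ _ _ _

end ListSup

/-! ### Programs -/

section Run

variable {k : ℕ} {R : Type u} [CommRing R]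

/-- The states of the program with instructions `c` at the point `x`. -/
def run (x : Fin k → R) (c : Fin (k + 2) → ℕ → R) : ℕ → R × R
  | 0 => (0, 0)
  | i + 1 => ((run x c i).1 + c 0 i * (run x c i).2,
      (∑ j : Fin k, c j.succ.succ i * x j) * (run x c i).2 + c 1 i)

/-- Applied to evaluation, this links the symbolic run at the variables with the run at a point. -/
theorem map_run {S : Type v} [CommRing S] (f : R →+* S) (x : Fin k → R) (c : Fin (k + 2) → ℕ → R)
    (n : ℕ) :
    run (fun j => f (x j)) (fun j i => f (c j i)) n =
      (f (run x c n).1, f (run x c n).2) := by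
  induction n with
  | zero => simp [run]
  | succ n ih => simp [run, ih, map_sum]

theorem run_congr (x : Fin k → R) {c c' : Fin (k + 2) → ℕ → R} {n : ℕ}
    (h : ∀ j, ∀ i < n, c j i = c' j i) : run x c n = run x c' n := by
  induction n with
  | zero => rfl
  | succ n ih =>
    have e := ih fun j i hi => h j i (hi.trans n.lt_succ_self)
    simp only [run, e, h _ n n.lt_succ_self]

end Run

/-! ### Every polynomial has a program. -/

section Reach

open MvPolynomial

variable {k : ℕ} {F : Type u} [Field F]

/-- A pair of polynomials is reachable when it is a state of some program. -/
def Reachable (st : MvPolynomial (Fin k) F × MvPolynomial (Fin k) F) : Prop :=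
  ∃ (c : Fin (k + 2) → ℕ → F) (n : ℕ), 0 < n ∧ run X (fun j i => C (c j i)) n = st

theorem Reachable.step {S T : MvPolynomial (Fin k) F} (h : Reachable (S, T)) (d e : F)
    (l : Fin k → F) : Reachable (S + C d * T, (∑ j, C (l j) * X j) * T + C e) := by
  obtain ⟨c, n, -, hc⟩ := h
  let a : Fin (k + 2) → F := Fin.cons d (Fin.cons e l)
  -- The new instruction is appended at position `n`; later positions are never executed.
  refine ⟨fun j i => if i < n then c j i else a j, n + 1, n.succ_pos, ?_⟩
  have hn : run (R := MvPolynomial (Fin k) F) X (fun j i => C (if i < n then c j i else a j)) n =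
      (S, T) := by
    rw [← hc]
    exact run_congr _ fun j i hi => by simp [hi]
  have a0 : a 0 = d := rfl
  have a1 : a 1 = e := rfl
  have a2 : ∀ j : Fin k, a j.succ.succ = l j := fun j => rfl
  simp [run, hn, a0, a1, a2]

theorem Reachable.reset {S T : MvPolynomial (Fin k) F} (h : Reachable (S, T)) (e : F) :
    Reachable (S, C e) := by
  simpa using h.step 0 e 0

/-- The linear form is taken to be the single variable `X j`, and both constants vanish. -/
theorem Reachable.mul_X {S T : MvPolynomial (Fin k) F} (h : Reachable (S, T)) (j : Fin k) :
    Reachable (S, T * X j) := by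
  have := h.step 0 0 (Pi.single j 1)
  have e : ∑ i, C (Pi.single (M := fun _ => F) j 1 i) * X i =
      (X j : MvPolynomial (Fin k) F) := by
    rw [Finset.sum_eq_single j] <;> simp +contextual
  rw [e] at this
  simpa [mul_comm] using this

theorem Reachable.add {S T : MvPolynomial (Fin k) F} (h : Reachable (S, T)) :
    Reachable (S + T, 0) := by
  simpa using h.step 1 0 0

theorem Reachable.mul_monomial {S T : MvPolynomial (Fin k) F} (m : Fin k →₀ ℕ)
    (h : Reachable (S, T)) : Reachable (S, T * monomial m 1) := by
  induction m using Finsupp.induction_linear generalizing T with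
  | zero => simpa using h
  | add f g hf hg =>
    have e : (monomial (f + g) 1 : MvPolynomial (Fin k) F) = monomial f 1 * monomial g 1 := by
      simp
    rw [e, ← mul_assoc]
    exact hg (hf h)
  | single i n =>
    rw [← X_pow_eq_monomial]
    induction n with
    | zero => simpa using h
    | succ n ih =>
      rw [pow_succ, ← mul_assoc]
      exact ih.mul_X i

theorem reachable_zero : Reachable ((0, 0) : MvPolynomial (Fin k) F × MvPolynomial (Fin k) F) :=
  -- One idle instruction, because `List(F)` has no empty tuple.
  ⟨fun _ _ => 0, 1, one_pos, by simp [run]⟩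

/-- For each term, load the coefficient into `T`, multiply by the variables, then add to `S` and
clear `T`. -/
theorem Reachable.add_polynomial {S : MvPolynomial (Fin k) F} (P : MvPolynomial (Fin k) F)
    (h : Reachable (S, 0)) : Reachable (S + P, 0) := by
  induction P using MvPolynomial.induction_on' generalizing S with
  | monomial m a =>
    have := ((h.reset a).mul_monomial m).add
    rwa [C_mul_monomial, mul_one] at this
  | add P Q hP hQ =>
    rw [← add_assoc]
    exact hQ (hP h)

/-- Every polynomial is computed by a program. -/
theorem exists_run_eq (P : MvPolynomial (Fin k) F) :
    ∃ (c : Fin (k + 2) → ℕ → F) (n : ℕ), 0 < n ∧ (run X (fun j i => C (c j i)) n).1 = P := by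
  obtain ⟨c, n, hn, h⟩ := reachable_zero.add_polynomial P
  exact ⟨c, n, hn, by rw [h, zero_add]⟩

end Reach

/-! ### Correctness of the definable value. -/

namespace ListSup

variable {k : ℕ} {F : Type u} [Field F]

/-- The instructions of a program. -/
def instr (s : Fin (k + 2) → {l : List F // l ≠ []}) (j : Fin (k + 2)) (i : ℕ) : F :=
  -- If all lists have length `n`, a run of `n` steps never reads the default.
  (s j).1[i]?.getD 0

theorem getElem?_eq_instr {s : Fin (k + 2) → {l : List F // l ≠ []}} {n : ℕ}
    (hs : ∀ j, (s j).1.length = n) (j : Fin (k + 2)) {i : ℕ} (hi : i < n) :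
    (s j).1[i]? = some (instr s j i) := by
  have : i < (s j).1.length := by rw [hs]; exact hi
  simp [instr, this]

theorem value_iff {s : Fin (k + 2) → {l : List F // l ≠ []}} {n : ℕ}
    (hs : ∀ j, (s j).1.length = n) (a : Fin k → F) (y : ListSup F) :
    Value (fun j => list (s j)) (fun j => elt (a j)) y ↔ y = elt (run a (instr s) n).1 := by
  have hlin : ∀ i < n, ∀ u, LinComb (fun j : Fin k => list (s j.succ.succ)) (fun j => elt (a j))
      (num (i + 1)) u ↔ u = elt (∑ j : Fin k, instr s j.succ.succ i * a j) := fun i hi u =>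
    linComb_iff (fun j : Fin k => s j.succ.succ) a (fun j => instr s j.succ.succ i) i
      (fun j => getElem?_eq_instr hs _ hi) u
  constructor
  · rintro ⟨S, T, _, _, _, _, hn, hm, rfl, rfl, hS, hT, hy, hstep⟩
    obtain ⟨σ, _, _, rfl, -⟩ := id hS
    obtain ⟨τ, _, _, rfl, -⟩ := id hT
    rw [holds_len, hs] at hn
    obtain ⟨n', rfl, rfl⟩ := succ_iff.1 hm
    obtain rfl : n' = n := by injection hn
    -- The initial entries and the step condition force both lists, up to the state after the last
    -- instruction.
    have key : ∀ i ≤ n', σ.1[i]? = some (run a (instr s) i).1 ∧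
        τ.1[i]? = some (run a (instr s) i).2 := by
      intro i hi
      induction i with
      | zero =>
        rw [show (num 1 : ListSup F) = num (0 + 1) from rfl, holds_entry] at hS hT
        obtain ⟨b, hb, e⟩ := hS
        obtain ⟨c, hc, e'⟩ := hT
        cases e
        cases e'
        exact ⟨hb, hc⟩
      | succ i ih =>
        obtain ⟨h₁, h₂⟩ := ih (Nat.le_of_succ_le hi)
        obtain ⟨e, x, t, x', t', w, u, z, he, hx, ht, hx', ht', hw, hwx, hu, hz, hze⟩ :=
          hstep (num (i + 1)) (num (i + 1 + 1)) (elt (instr s 0 i)) (succ_iff.2 ⟨_, rfl, rfl⟩)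
            (holds_entry.2 ⟨_, getElem?_eq_instr hs 0 hi, rfl⟩)
        simp only [holds_entry, h₁, h₂, getElem?_eq_instr hs 1 hi, Option.some.injEq,
          exists_eq_left'] at he hx ht
        subst he hx ht
        rw [hlin i hi] at hu
        subst hu
        rw [holds_eltMul] at hw hz
        subst hw hz
        rw [holds_eltAdd] at hwx hze
        subst hwx hze
        simpa [run] using And.intro hx' ht'
    rw [holds_entry, (key n' le_rfl).1] at hy
    simpa using hy
  · rintro rfl
    -- A run of `n` instructions has `n + 1` states.
    let σ : {l : List F // l ≠ []} := ⟨List.ofFn fun i : Fin (n + 1) => (run a (instr s) i).1,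
      by simp⟩
    let τ : {l : List F // l ≠ []} := ⟨List.ofFn fun i : Fin (n + 1) => (run a (instr s) i).2,
      by simp⟩
    have hσ : ∀ i ≤ n, σ.1[i]? = some (run a (instr s) i).1 := fun i hi => by
      simp only [σ, List.getElem?_ofFn, Nat.lt_succ_of_le hi, dif_pos]
    have hτ : ∀ i ≤ n, τ.1[i]? = some (run a (instr s) i).2 := fun i hi => by
      simp only [τ, List.getElem?_ofFn, Nat.lt_succ_of_le hi, dif_pos]
    refine ⟨list σ, list τ, num n, num (n + 1), num 1, elt 0, ?_, succ_iff.2 ⟨n, rfl, rfl⟩, rfl,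
      rfl, ?_, ?_, ?_, ?_⟩
    · rw [holds_len, hs]
    · exact holds_entry.2 ⟨_, hσ 0 (Nat.zero_le _), rfl⟩
    · exact holds_entry.2 ⟨_, hτ 0 (Nat.zero_le _), rfl⟩
    · exact holds_entry.2 ⟨_, hσ n le_rfl, rfl⟩
    · intro i j d hij hd
      obtain ⟨m, rfl, rfl⟩ := succ_iff.1 hij
      have hd' := hd
      -- Only positive places carry entries, so `m` is a successor.
      obtain ⟨-, -, i, -, -, hm, -⟩ := hd'
      obtain rfl : m = i + 1 := by injection hm
      obtain ⟨d, hd'', rfl⟩ := holds_entry.1 hd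
      have hi : i < n := by
        rw [← hs 0]
        exact (List.getElem?_eq_some_iff.1 hd'').1
      obtain rfl : instr s 0 i = d := by
        rw [getElem?_eq_instr hs 0 hi] at hd''
        exact Option.some.inj hd''
      exact ⟨_, _, _, _, _, _, _, _, holds_entry.2 ⟨_, getElem?_eq_instr hs 1 hi, rfl⟩,
        holds_entry.2 ⟨_, hσ i hi.le, rfl⟩, holds_entry.2 ⟨_, hτ i hi.le, rfl⟩,
        holds_entry.2 ⟨_, hσ (i + 1) hi, rfl⟩, holds_entry.2 ⟨_, hτ (i + 1) hi, rfl⟩,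
        holds_eltMul.2 rfl, holds_eltAdd.2 rfl, (hlin i hi _).2 rfl, holds_eltMul.2 rfl,
        holds_eltAdd.2 rfl⟩

end ListSup

/-! ### The interpretation of the polynomial ring -/

namespace ListSup

variable {k : ℕ} {F : Type u} [Field F]

/-- The tuples of lists of the same length, which are the programs. -/
def IsProgram (p : Fin (k + 2) → ListSup F) : Prop :=
  ∃ n, ∀ j, Holds .len ![p j, n]

theorem isProgram_iff {p : Fin (k + 2) → ListSup F} :
    IsProgram p ↔ ∃ (s : Fin (k + 2) → {l : List F // l ≠ []}) (n : ℕ),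
      (∀ j, (s j).1.length = n) ∧ p = fun j => list (s j) := by
  constructor
  · rintro ⟨n, hn⟩
    choose s hs hsn using hn
    have e : ∀ j, n = num (s j).1.length := hsn
    refine ⟨s, (s 0).1.length, fun j => ?_, funext hs⟩
    have := (e j).symm.trans (e 0)
    injection this
  · rintro ⟨s, n, hs, rfl⟩
    exact ⟨num n, fun j => holds_len.2 (by rw [hs])⟩

/-- The polynomial that is computed by a tuple of lists. -/
def toPolynomial (s : Fin (k + 2) → {l : List F // l ≠ []}) : MvPolynomial (Fin k) F :=
  (run MvPolynomial.X (fun j i => MvPolynomial.C (instr s j i)) (s 0).1.length).1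

theorem eval_toPolynomial (s : Fin (k + 2) → {l : List F // l ≠ []}) (a : Fin k → F) :
    MvPolynomial.eval a (toPolynomial s) = (run a (instr s) (s 0).1.length).1 := by
  have := map_run (MvPolynomial.eval a) MvPolynomial.X
    (fun j i => MvPolynomial.C (instr s j i)) (s 0).1.length
  simp only [MvPolynomial.eval_X, MvPolynomial.eval_C] at this
  exact (congrArg Prod.fst this).symm

theorem exists_toPolynomial_eq (P : MvPolynomial (Fin k) F) :
    ∃ s : Fin (k + 2) → {l : List F // l ≠ []},
      IsProgram (fun j => list (s j)) ∧ toPolynomial s = P := by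
  obtain ⟨c, n, hn, h⟩ := exists_run_eq P
  let s : Fin (k + 2) → {l : List F // l ≠ []} := fun j =>
    ⟨List.ofFn fun i : Fin n => c j i, by simp [hn.ne']⟩
  have hs : ∀ j, (s j).1.length = n := fun j => by simp [s]
  refine ⟨s, isProgram_iff.2 ⟨s, n, hs, rfl⟩, ?_⟩
  rw [← h, toPolynomial, hs]
  refine congrArg Prod.fst (run_congr _ fun j i hi => ?_)
  simp only [instr, s, List.getElem?_ofFn, hi, dif_pos, Option.getD_some]

/-- The polynomial that is computed by a program. -/
def polynomial (p : Fin (k + 2) → ListSup F) (hp : IsProgram p) : MvPolynomial (Fin k) F :=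
  toPolynomial (isProgram_iff.1 hp).choose

theorem value_iff_eval {p : Fin (k + 2) → ListSup F} (hp : IsProgram p) (a : Fin k → F)
    (y : ListSup F) :
    Value p (fun j => elt (a j)) y ↔ y = elt (MvPolynomial.eval a (polynomial p hp)) := by
  obtain ⟨n, hs, e⟩ := (isProgram_iff.1 hp).choose_spec
  rw [polynomial, eval_toPolynomial, hs, ← value_iff hs, ← e]

/-- The choice in `polynomial` is harmless: `list` is injective, so a program determines its lists.
-/
theorem exists_polynomial_eq (P : MvPolynomial (Fin k) F) :
    ∃ (p : Fin (k + 2) → ListSup F) (hp : IsProgram p), polynomial p hp = P := by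
  obtain ⟨s, hs, rfl⟩ := exists_toPolynomial_eq P
  refine ⟨_, hs, congrArg toPolynomial (funext fun j => ?_)⟩
  obtain ⟨n, -, e⟩ := (isProgram_iff.1 hs).choose_spec
  have := congrFun e j
  injection this with this
  exact this.symm

/-- The relation `R` holds for the values of the programs `p i` at all points. -/
def Pointwise {m : ℕ} (R : (Fin m → ListSup F) → Prop)
    (p : Fin m → Fin (k + 2) → ListSup F) : Prop :=
  ∀ x : Fin k → ListSup F, (∀ j, Holds .isElt ![x j]) → ∀ y : Fin m → ListSup F,
    (∀ i, Value (p i) x (y i)) → R y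

/-- At each point a program has exactly one value, so the quantifier over values amounts to
substitution. -/
theorem pointwise_iff {m : ℕ} {R : (Fin m → ListSup F) → Prop}
    {p : Fin m → Fin (k + 2) → ListSup F} (hp : ∀ i, IsProgram (p i)) :
    Pointwise R p ↔
      ∀ a : Fin k → F, R fun i => elt (MvPolynomial.eval a (polynomial (p i) (hp i))) := by
  constructor
  · intro h a
    exact h (fun j => elt (a j)) (fun j => ⟨a j, rfl⟩) _ fun i => (value_iff_eval (hp i) a _).2 rfl
  · intro h x hx y hy
    choose a ha using hx
    obtain rfl : x = fun j => elt (a j) := funext ha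
    obtain rfl : y = fun i => elt (MvPolynomial.eval a (polynomial (p i) (hp i))) :=
      funext fun i => (value_iff_eval (hp i) a _).1 (hy i)
    exact h a

theorem isDef_isProgram {α : Type} (p : Fin (k + 2) → α) :
    IsDef fun v : α → ListSup F => IsProgram fun j => v (p j) :=
  .ex <| .forall_finite fun _ => .rel₂ _ _ _

theorem isDef_pointwise {α : Type} {m : ℕ} {R : (Fin m → ListSup F) → Prop} (hR : IsDef R)
    (p : Fin m → Fin (k + 2) → α) :
    IsDef fun v : α → ListSup F => Pointwise R fun i j => v (p i j) :=
  .forall_tuple <| .imp (.forall_finite fun _ => .rel₁ _ _) <| .forall_tuple <|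
    .imp (.forall_finite fun _ => isDef_value _ _ _) (hR.comp _)

/-- The graphs of the ring operations of `F` in `𝕊(F, ℕ)`. -/
def ringGraph : ∀ {n : ℕ}, Language.ring.Functions n → (Fin (n + 1) → ListSup F) → Prop
  | _, .add, y => Holds .eltAdd ![y 0, y 1, y 2]
  | _, .mul, y => Holds .eltMul ![y 0, y 1, y 2]
  | _, .neg, y => ∃ z, Holds .eltZero ![z] ∧ Holds .eltAdd ![y 0, y 1, z]
  | _, .zero, y => Holds .eltZero ![y 0]
  | _, .one, y => Holds .eltOne ![y 0]

theorem isDef_ringGraph {n : ℕ} (f : Language.ring.Functions n) :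
    IsDef (ringGraph (F := F) f) := by
  cases f
  · exact IsDef.rel₃ .eltAdd (0 : Fin 3) 1 2
  · exact IsDef.rel₃ .eltMul (0 : Fin 3) 1 2
  · refine IsDef.ex (P := fun (v : Fin 2 → ListSup F) z =>
      Holds .eltZero ![z] ∧ Holds .eltAdd ![v 0, v 1, z]) (.and (.rel₁ _ _) (.rel₃ _ _ _ _))
  · exact IsDef.rel₁ .eltZero (0 : Fin 1)
  · exact IsDef.rel₁ .eltOne (0 : Fin 1)

/-- This rests on `MvPolynomial.funext_iff`: over an infinite field a polynomial is determined by
its values. -/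
theorem forall_ringGraph_iff [Infinite F] {n : ℕ} (f : Language.ring.Functions n)
    (P : Fin (n + 1) → MvPolynomial (Fin k) F) :
    (∀ a : Fin k → F, ringGraph f fun i => elt (MvPolynomial.eval a (P i))) ↔
      (letI := compatibleRingOfRing (MvPolynomial (Fin k) F)
       Structure.funMap f (fun i => P i.castSucc) = P (Fin.last n)) := by
  let _ := compatibleRingOfRing (MvPolynomial (Fin k) F)
  cases f
  · change _ ↔ P 0 + P 1 = P 2
    rw [eq_comm, MvPolynomial.funext_iff]
    simp [ringGraph]
  · change _ ↔ P 0 * P 1 = P 2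
    rw [eq_comm, MvPolynomial.funext_iff]
    simp [ringGraph]
  · change _ ↔ -P 0 = P 1
    rw [neg_eq_iff_add_eq_zero, eq_comm, MvPolynomial.funext_iff]
    simp [ringGraph]
  · change _ ↔ 0 = P 0
    rw [eq_comm, MvPolynomial.funext_iff]
    simp [ringGraph]
  · change _ ↔ 1 = P 0
    rw [eq_comm, MvPolynomial.funext_iff]
    simp [ringGraph]

end ListSup

open ListSup

/-- The code of the interpretation of `F[x₁, …, xₖ]` in `𝕊(F, ℕ)`, in which a polynomial is
represented by the programs that compute it. -/
def polynomialCode (F : Type u) [Field F] (k : ℕ) : Code Language.ring listLang where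
  dim := k + 2
  par := 0
  dom := (isDef_isProgram (F := F) (k := k) Sum.inl).choose
  eqv := (isDef_pointwise (F := F) (k := k) (.eq (0 : Fin 2) 1)
    fun i j => Sum.inl (i, j)).choose
  func f := (isDef_pointwise (F := F) (k := k) (isDef_ringGraph f)
    fun i j => Sum.inl (i, j)).choose
  -- An arbitrary choice, as the language of rings has no relation symbols.
  rel _ := ⊥

theorem polynomialCode_isRegular (F : Type u) [Field F] [Infinite F] (k : ℕ) :
    (polynomialCode F k).IsRegularRingInterpretation ⊤ (ListSup F) (MvPolynomial (Fin k) F) := by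
  let _ := compatibleRingOfRing (MvPolynomial (Fin k) F)
  -- The code has no parameters, so the only tuple is the empty one.
  refine ⟨⟨fun i => i.elim0, Formula.realize_top.2 trivial⟩, fun p _ => ?_⟩
  have hdom : ∀ x : Fin (k + 2) → ListSup F,
      (polynomialCode F k).dom.Realize (Sum.elim x p) ↔ IsProgram x := fun x =>
    (isDef_isProgram (F := F) (k := k) Sum.inl).choose_spec _
  have hprog : ∀ x : (polynomialCode F k).Dom (ListSup F) p, IsProgram x.1 :=
    fun x => (hdom x.1).1 x.2
  refine Code.exists_equiv_of_parametrization (fun x => polynomial x.1 (hprog x)) ?_ ?_ ?_ ?_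
  · intro P
    obtain ⟨x, hx, rfl⟩ := exists_polynomial_eq P
    exact ⟨⟨x, (hdom x).2 hx⟩, rfl⟩
  · intro x y
    refine ((isDef_pointwise (F := F) (k := k) (.eq (0 : Fin 2) 1)
      fun i j => Sum.inl (i, j)).choose_spec _).trans ?_
    refine (pointwise_iff (p := fun i => (![x, y] i).1) fun i => hprog (![x, y] i)).trans ?_
    rw [MvPolynomial.funext_iff]
    exact forall_congr' fun a => (elt.injEq _ _).to_iff
  · intro n f x
    refine ((isDef_pointwise (F := F) (k := k) (isDef_ringGraph f)
      fun i j => Sum.inl (i, j)).choose_spec _).trans ?_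
    refine (pointwise_iff (p := fun i => (x i).1) fun i => hprog (x i)).trans ?_
    exact forall_ringGraph_iff f fun i => polynomial (x i).1 (hprog (x i))
  · intro n r
    cases r

end NonstandardPolynomials

end

open NonstandardPolynomials
theorem mainTheorem12 (F : Type u) [Field F] [Infinite F] (k : ℕ) :
    -- the polynomial ring is regularly interpretable in the list superstructure of `F`
    (∃ (Γ : Code FirstOrder.Language.ring listLang) (φ : listLang.Formula (Fin Γ.par)),
      Γ.IsRegularRingInterpretation φ (ListSup F) (MvPolynomial (Fin k) F)) ∧
    -- every nonstandard model of it is nonstandardly Noetherian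
    ∀ (Γ : Code FirstOrder.Language.ring listLang) (φ : listLang.Formula (Fin Γ.par)),
      Γ.IsRegularRingInterpretation φ (ListSup F) (MvPolynomial (Fin k) F) →
      ∀ (M : Type v) [listLang.Structure M], (M ≅[listLang] ListSup F) →
        (∃ q : Fin Γ.par → M, φ.Realize q) ∧
        ∀ q : Fin Γ.par → M, φ.Realize q →
          -- the nonstandard polynomial ring `Γ(M, q)` is well defined and a commutative ring
          ∃ (h : Γ.Admissible M q) (_ : CommRing (Γ.Carrier M q)),
            (FirstOrder.Ring.compatibleRingOfRing (Γ.Carrier M q)).toStructure =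
              Γ.toStructure h ∧
            -- a formula `Φ(p, n)` with parameters `c` that defines an ascending chain of ideals
            ∀ (r : ℕ) (Φ : listLang.Formula ((Fin Γ.dim ⊕ Unit) ⊕ Fin r)) (c : Fin r → M)
              (I : NumSort M → Ideal (Γ.Carrier M q)),
              (∀ (n : NumSort M) (x : Γ.Dom M q),
                Γ.cls x ∈ I n ↔ Φ.Realize (Sum.elim (Sum.elim x.1 fun _ => n.1) c)) →
              (∀ n₁ n₂ : NumSort M, n₁.Le n₂ → I n₁ ≤ I n₂) →
              ∃ m : NumSort M, ∀ n : NumSort M, m.Le n → I n = I m := by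
  refine ⟨⟨polynomialCode F k, ⊤, polynomialCode_isRegular F k⟩, fun Γ φ hΓ M _ hM =>
    ⟨transfer_exists hM φ hΓ.1, fun q hq => ?_⟩⟩
  obtain ⟨h, inst, hS⟩ := hΓ.exists_commRing hM q hq
  exact ⟨h, inst, hS, fun r Φ c I hI hmono => hΓ.exists_stable hM Φ q hq c h hS I hI hmono⟩
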